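/- **Setting.** Let $\mathbb{X}\subseteq\mathbb{R}$ be a closed set, unbounded above, with jump operators $\rho(t)=\sup\{s\in\mathbb{X}:s<t\}$ and $\sigma(t)=\inf\{s\in\mathbb{X}:s>t\}$ (with $\rho(\min\mathbb X)=\min\mathbb X$), let $t_0\in\mathbb{X}$, $[t_0,\infty)_{\mathbb X}=[t_0,\infty)\cap\mathbb X$, and assume $\sigma(\rho(t))=\rho(\sigma(t))=t$ for $t\in[t_0,\infty)_{\mathbb X}$. Put $\mu(t)=\sigma(t)-t$ and let $\Delta s$ denote the Lebesgue delta measure on $[t_0,\infty)_{\mathbb X}$. Let $$J=\begin{pmatrix}0&-I_n\\ I_n&0\end{pmatrix},\qquad A=\begin{pmatrix}A_1&0\\0&A_2\end{pmatrix}\ge 0,\qquad B=\begin{pmatrix}B_1&B_2\\B_3&B_4\end{pmatrix},$$ with rd-continuous $n\times n$ complex blocks on $[t_0,\infty)_{\mathbb X}$ such that $I_n+\mu B_2$ and $I_n+\mu B_3$ are invertible there. For $y=(y_1,y_2)$ write $\widehat y=(y_1,\,y_2\circ\rho)$; the same notation is used for matrix functions with $2n$ rows. Let $\mathscr U\in\mathbb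 C^{n\times n}$ be invertible, $\mathscr U_{2n}=\mathrm{diag}(\mathscr U,-\mathscr U^*)$, $\mathrm{Re}\,M=\frac12(M+M^*)$, and let $\lambda_0\in\mathbb C$ satisfy $\mathrm{Re}[\mathscr U_{2n}(\lambda_0A(t)+B(t))]\ge0$ for all $t\in[t_0,\infty)_{\mathbb X}$. Let $\Lambda$ be the set of $\lambda\in\mathbb C$ for which there is $\delta>0$ with $\mathrm{Re}[(\lambda-\lambda_0)\mathscr U_{2n}A(t)]\ge\delta\,\mathscr U_{2n}A(t)\mathscr U_{2n}^*$ for all $t\in[t_0,\infty)_{\mathbb X}$, and $\widetilde\Lambda$ the set of $\lambda\in\mathbb C$ for which there is $\delta>0$ with $\mathrm{Re}[(\lambda-\lambda_0)A(t)\mathscr U_{2n}^{-1*}]\ge\delta\,\mathscr U_{2n}^{-1}A(t)\mathscr U_{2n}^{-1*}$ for all $t\in[t_0,\infty)_{\mathbb X}$. Fix $\lambda\in\Lambda\cap\widetilde\Lambda$. Let $Y=(\theta\,|\,\phi)$ and $Z=(\eta\,|\,\chi)$ be the fundamental systems of $J\widehat y^{\Delta}=(\lambda A+B)y$ and $J\widehat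 z^{\Delta}=(\overline\lambda A+B^*)z$ on $[t_0,\infty)_{\mathbb X}$ with $\widehat Y(t_0)=\widehat Z(t_0)=J$. Let $M\in D(\infty,\lambda)$, i.e. for some $t_1$ and all $t\in[t_0,\infty)_{\mathbb X}$ with $t\ge t_1$, $$(\widehat\theta(t)+\widehat\phi(t)M)^*\,\mathscr U_{2n}J\,(\widehat\theta(t)+\widehat\phi(t)M)\le0 ,$$ and put $\psi=\theta+\phi M$, $\zeta=\eta+\chi M^*$. Let $L^2_A$ be the space of measurable $f:[t_0,\infty)_{\mathbb X}\to\mathbb C^{2n}$ with $\int_{t_0}^\infty f^*Af\,\Delta t<\infty$. With $$N=\begin{pmatrix}0&0\\-\mu(I_n+\mu B_2)^{-1}&0\end{pmatrix},\qquad G(t,s)=\begin{cases}\psi(t)\chi^*(s),& s<t,\\ \phi(t)\zeta^*(s)+N(t)\delta_{ts},& t\le s,\end{cases}$$ where $\delta_{ts}=1/\mu(t)$ if $s=t$ and $\mu(t)>0$, and $\delta_{ts}=0$ otherwise (note $N(t)=0$ when $\mu(t)=0$), define $$(R_\lambda f)(t)=\int_{t_0}^\infty G(t,s)A(s)f(s)\,\Delta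 s,\qquad t\in[t_0,\infty)_{\mathbb X}\cup\{\rho(t_0)\}.$$ **Lemma.** For every $f\in L^2_A$ the integrals defining $R_\lambda f$ converge absolutely, and: 1. $y=R_\lambda f$ is a solution of $$J\widehat y^{\Delta}(t)=(\lambda A(t)+B(t))y(t)+A(t)f(t),$$ that is, $y\in L^2_A$, $\widehat y$ is locally absolutely continuous on $[t_0,\infty)_{\mathbb X}$, and at $\Delta$-almost every $t\in[t_0,\infty)_{\mathbb X}$, as well as at every $t\in[t_0,\infty)_{\mathbb X}$ at which $Af$ is continuous, $\widehat y$ is delta differentiable and the equation holds; 2. $(R_\lambda f)_2(\rho(t_0))=0$ and $\widehat\chi^*(t_0)\,J\,\widehat{R_\lambda f}(t_0)=0$; 3. $\displaystyle\lim_{t\to\infty,\;t\in\mathbb X}\widehat\zeta^*(t)\,J\,\widehat{R_\lambda f}(t)=0$; 4. for all $t\in[t_0,\infty)_{\mathbb X}$, with absolutely convergent integrals, $$\widehat{R_\lambda f}(t)=\widehat\psi(t)\int_{t_0}^{t}\chi^*(s)A(s)f(s)\,\Delta s+\widehat\phi(t)\int_t^\infty\zeta^*(s)A(s)f(s)\,\Delta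 s .$$ -/

import Mathlib

open Matrix MeasureTheory Filter Topology
open scoped ComplexOrder

/-! ### Time scales -/

/-- Backward jump operator `ρ(t) = sup {s ∈ X : s < t}`, with the usual convention `ρ(min X) = min X`. -/
noncomputable def backwardJump (X : Set ℝ) (t : ℝ) : ℝ :=
  open Classical in if (X ∩ Set.Iio t).Nonempty then sSup (X ∩ Set.Iio t) else t

/-- Forward jump operator `σ(t) = inf {s ∈ X : s > t}`, with the usual convention `σ(max X) = max X`. -/
noncomputable def forwardJump (X : Set ℝ) (t : ℝ) : ℝ :=
  open Classical in if (X ∩ Set.Ioi t).Nonempty then sInf (X ∩ Set.Ioi t) else t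

/-- Graininess `μ(t) = σ(t) - t`. -/
noncomputable def graininess (X : Set ℝ) (t : ℝ) : ℝ := forwardJump X t - t

/-- The part `[t₀,∞)_X` of the time scale. -/
def tsIci (X : Set ℝ) (t₀ : ℝ) : Set ℝ := X ∩ Set.Ici t₀

/-- Rd-continuity on `[t₀,∞)_X`: continuity at right-dense points and existence of the left limit
at left-dense points. -/
def RdContinuous {E : Type*} [TopologicalSpace E] (X : Set ℝ) (t₀ : ℝ) (g : ℝ → E) : Prop :=
  ∀ t ∈ tsIci X t₀,
    (forwardJump X t = t → ContinuousWithinAt g (tsIci X t₀) t) ∧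
    (backwardJump X t = t → ∃ L : E, Tendsto g (𝓝[tsIci X t₀ ∩ Set.Iio t] t) (𝓝 L))

/-- `d` is the delta derivative at `t` of the function `g` on `[t₀,∞)_X`: the difference
`g(σ(t)) - g(s) - (σ(t) - s) d` is `o(|σ(t) - s|)` as `s → t` in `[t₀,∞)_X`. -/
def HasDeltaDerivAt {E : Type*} [NormedAddCommGroup E] [NormedSpace ℝ E]
    (X : Set ℝ) (t₀ : ℝ) (g : ℝ → E) (d : E) (t : ℝ) : Prop :=
  (fun s => g (forwardJump X t) - g s - (forwardJump X t - s) • d)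
    =o[𝓝[tsIci X t₀] t] (fun s => forwardJump X t - s)

/-- The Lebesgue delta measure on `[t₀,∞)_X`, i.e. the measure concentrated on `[t₀,∞)_X` that gives
`[a,b)_X` the mass `b - a` for all `a ≤ b` in `[t₀,∞)_X`. It is the image of Lebesgue measure on
`[t₀,∞)` under the retraction `x ↦ max {s ∈ X : s ≤ x}`: thus `∫ g Δ` is the Lebesgue integral of
the extension of `g` that takes the value `g(t)` on the gap `[t, σ(t))`. -/
noncomputable def deltaMeasure (X : Set ℝ) (t₀ : ℝ) : Measure ℝ :=
  (volume.restrict (Set.Ici t₀)).map (fun x => sSup (X ∩ Set.Iic x))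

/-- Absolute continuity on each compact piece `[t₀,b]_X` of `[t₀,∞)_X`. -/
def LocallyAC {E : Type*} [NormedAddCommGroup E] (X : Set ℝ) (t₀ : ℝ) (g : ℝ → E) : Prop :=
  ∀ b ∈ tsIci X t₀, ∀ ε > (0 : ℝ), ∃ δ > (0 : ℝ), ∀ (N : ℕ) (u v : Fin N → ℝ),
    (∀ k, u k ∈ tsIci X t₀ ∧ v k ∈ tsIci X t₀ ∧ u k ≤ v k ∧ v k ≤ b) →
    (Pairwise fun k l => Disjoint (Set.Ico (u k) (v k)) (Set.Ico (u l) (v l))) →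
    ∑ k, (v k - u k) < δ → ∑ k, ‖g (v k) - g (u k)‖ < ε

/-! ### Complex Hamiltonian systems on Sturmian time scales -/

/-- The data of a complex Hamiltonian system `J ŷ^Δ = (λ A + B) y` on `[t₀,∞)_X`: a closed set `X`,
unbounded above and Sturmian on `[t₀,∞)_X`, rd-continuous blocks of
`A = diag(A₁, A₂) ≥ 0` and `B = (B₁ B₂; B₃ B₄)`, with `I + μ B₂` and `I + μ B₃` invertible. -/
structure HamiltonianSystem (n : ℕ) where
  X : Set ℝ
  t₀ : ℝ
  isClosed_X : IsClosed X
  unbounded_X : ¬ BddAbove X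
  t₀_mem : t₀ ∈ X
  sturmian : ∀ t ∈ tsIci X t₀,
    forwardJump X (backwardJump X t) = t ∧ backwardJump X (forwardJump X t) = t
  (A₁ A₂ B₁ B₂ B₃ B₄ : ℝ → Matrix (Fin n) (Fin n) ℂ)
  rd_A₁ : RdContinuous X t₀ A₁
  rd_A₂ : RdContinuous X t₀ A₂
  rd_B₁ : RdContinuous X t₀ B₁
  rd_B₂ : RdContinuous X t₀ B₂
  rd_B₃ : RdContinuous X t₀ B₃
  rd_B₄ : RdContinuous X t₀ B₄
  A_nonneg : ∀ t ∈ tsIci X t₀, (fromBlocks (A₁ t) 0 0 (A₂ t)).PosSemidef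
  isUnit_B₂ : ∀ t ∈ tsIci X t₀, IsUnit (1 + (graininess X t : ℂ) • B₂ t)
  isUnit_B₃ : ∀ t ∈ tsIci X t₀, IsUnit (1 + (graininess X t : ℂ) • B₃ t)

/-- Real part `(M + M*) / 2` of a square matrix. -/
noncomputable def matRe {m : Type*} (M : Matrix m m ℂ) : Matrix m m ℂ := (1 / 2 : ℂ) • (M + Mᴴ)

/-- `𝒰₂ₙ = diag(𝒰, -𝒰*)`. -/
def bigU {n : ℕ} (U : Matrix (Fin n) (Fin n) ℂ) : Matrix (Fin n ⊕ Fin n) (Fin n ⊕ Fin n) ℂ :=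
  fromBlocks U 0 0 (-Uᴴ)

/-- The solution `θ + φ M` built from a fundamental system `Y = (θ|φ)`. -/
noncomputable def weylSolution {n : ℕ} (Y : ℝ → Matrix (Fin n ⊕ Fin n) (Fin n ⊕ Fin n) ℂ)
    (M : Matrix (Fin n) (Fin n) ℂ) : ℝ → Matrix (Fin n ⊕ Fin n) (Fin n) ℂ :=
  fun t => (Y t).toCols₁ + (Y t).toCols₂ * M

namespace HamiltonianSystem

variable {n : ℕ} (S : HamiltonianSystem n)

/-- The half-line `[t₀,∞)_X`. -/
def T : Set ℝ := tsIci S.X S.t₀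

/-- Delta measure on `[t₀,∞)_X`. -/
noncomputable def vol : Measure ℝ := deltaMeasure S.X S.t₀

/-- `A = diag(A₁, A₂)`. -/
def A (t : ℝ) : Matrix (Fin n ⊕ Fin n) (Fin n ⊕ Fin n) ℂ := fromBlocks (S.A₁ t) 0 0 (S.A₂ t)

/-- `B = (B₁ B₂; B₃ B₄)`. -/
def B (t : ℝ) : Matrix (Fin n ⊕ Fin n) (Fin n ⊕ Fin n) ℂ :=
  fromBlocks (S.B₁ t) (S.B₂ t) (S.B₃ t) (S.B₄ t)

/-- The partial left shift `ŷ = (y₁, y₂ ∘ ρ)`. -/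
noncomputable def hat (y : ℝ → Fin n ⊕ Fin n → ℂ) : ℝ → Fin n ⊕ Fin n → ℂ :=
  fun t => Sum.elim (fun i => y t (Sum.inl i)) (fun i => y (backwardJump S.X t) (Sum.inr i))

/-- The partial left shift, applied to each column of a matrix-valued function. -/
noncomputable def hatM {m : Type*} (Y : ℝ → Matrix (Fin n ⊕ Fin n) m ℂ) :
    ℝ → Matrix (Fin n ⊕ Fin n) m ℂ :=
  fun t => of fun i j => S.hat (fun s k => Y s k j) t i

/-- At the point `t`, the function `ŷ` is delta differentiable and `J ŷ^Δ = C y + g`. -/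
def SolvesAt (C : ℝ → Matrix (Fin n ⊕ Fin n) (Fin n ⊕ Fin n) ℂ) (g y : ℝ → Fin n ⊕ Fin n → ℂ)
    (t : ℝ) : Prop :=
  ∃ d : Fin n ⊕ Fin n → ℂ,
    HasDeltaDerivAt S.X S.t₀ (S.hat y) d t ∧ Matrix.J (Fin n) ℂ *ᵥ d = C t *ᵥ y t + g t

/-- `Y` is the fundamental system of `J ŷ^Δ = C y` on `[t₀,∞)_X` with `Ŷ(t₀) = J`. -/
def IsFundamentalSystem (C Y : ℝ → Matrix (Fin n ⊕ Fin n) (Fin n ⊕ Fin n) ℂ) : Prop :=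
  (∀ j, ∀ t ∈ S.T, S.SolvesAt C 0 (fun s i => Y s i j) t) ∧ S.hatM Y S.t₀ = Matrix.J (Fin n) ℂ

/-- Coefficient matrix `λ A + B` of the system. -/
def coeff (lam : ℂ) (t : ℝ) : Matrix (Fin n ⊕ Fin n) (Fin n ⊕ Fin n) ℂ := lam • S.A t + S.B t

/-- Coefficient matrix `λ̄ A + B*` of the adjoint system. -/
def adjCoeff (lam : ℂ) (t : ℝ) : Matrix (Fin n ⊕ Fin n) (Fin n ⊕ Fin n) ℂ :=
  star lam • S.A t + (S.B t)ᴴ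

/-- `(λ₀, 𝒰₂ₙ)` is an admissible pair: `Re [𝒰₂ₙ (λ₀ A + B)] ≥ 0` on `[t₀,∞)_X`. -/
def Admissible (lam₀ : ℂ) (U : Matrix (Fin n) (Fin n) ℂ) : Prop :=
  ∀ t ∈ S.T, (matRe (bigU U * S.coeff lam₀ t)).PosSemidef

/-- The set `Λ(λ₀, 𝒰₂ₙ)`. -/
def Lam (lam₀ : ℂ) (U : Matrix (Fin n) (Fin n) ℂ) : Set ℂ :=
  {lam | ∃ δ : ℝ, 0 < δ ∧ ∀ t ∈ S.T,
    (matRe ((lam - lam₀) • (bigU U * S.A t)) - (δ : ℂ) • (bigU U * S.A t * (bigU U)ᴴ)).PosSemidef}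

/-- The set `Λ̃(λ₀, 𝒰₂ₙ⁻¹)`. -/
def LamTilde (lam₀ : ℂ) (U : Matrix (Fin n) (Fin n) ℂ) : Set ℂ :=
  {lam | ∃ δ : ℝ, 0 < δ ∧ ∀ t ∈ S.T,
    (matRe ((lam - lam₀) • (S.A t * ((bigU U)⁻¹)ᴴ))
      - (δ : ℂ) • ((bigU U)⁻¹ * S.A t * ((bigU U)⁻¹)ᴴ)).PosSemidef}

/-- The Weyl-Sims set `D(t, λ)`, where `Y = (θ|φ)` is the fundamental system for `λ`. -/
def weylSet (U : Matrix (Fin n) (Fin n) ℂ) (Y : ℝ → Matrix (Fin n ⊕ Fin n) (Fin n ⊕ Fin n) ℂ)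
    (t : ℝ) : Set (Matrix (Fin n) (Fin n) ℂ) :=
  {l | (-((S.hatM (weylSolution Y l) t)ᴴ * (bigU U * Matrix.J (Fin n) ℂ) *
    S.hatM (weylSolution Y l) t)).PosSemidef}

/-- The limiting set `D(∞, λ) = ⋂ D(t, λ)`, over `t ≥ t₁` in `[t₀,∞)_X`. -/
def weylLimitSet (U : Matrix (Fin n) (Fin n) ℂ)
    (Y : ℝ → Matrix (Fin n ⊕ Fin n) (Fin n ⊕ Fin n) ℂ) (t₁ : ℝ) :
    Set (Matrix (Fin n) (Fin n) ℂ) :=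
  ⋂ t ∈ S.T ∩ Set.Ici t₁, S.weylSet U Y t

/-- `f` represents an element of `L²_A(t₀,∞)_X`. -/
def MemL2A (f : ℝ → Fin n ⊕ Fin n → ℂ) : Prop :=
  AEStronglyMeasurable f S.vol ∧ Integrable (fun t => star (f t) ⬝ᵥ (S.A t *ᵥ f t)) S.vol

/-- The matrix `N = (0 0; -μ (I + μ B₂)⁻¹ 0)`. -/
noncomputable def N (t : ℝ) : Matrix (Fin n ⊕ Fin n) (Fin n ⊕ Fin n) ℂ :=
  fromBlocks 0 0 (-((graininess S.X t : ℂ) • (1 + (graininess S.X t : ℂ) • S.B₂ t)⁻¹)) 0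

/-- The delta function `δ_{ts}`: the density at `s` of the unit mass at a right-scattered point `t`.
At a right-dense `t` there is no such function; it enters only through the product `N(t) δ_{ts}`,
where `N(t) = 0` if `t` is right-dense, and it gets the value `0` there. -/
noncomputable def diracDelta (t s : ℝ) : ℝ := if s = t then (graininess S.X t)⁻¹ else 0

/-- The Green's matrix `G(t, s, λ)` built from `ψ, φ, χ, ζ`. -/
noncomputable def green (ψ φ χ ζ : ℝ → Matrix (Fin n ⊕ Fin n) (Fin n) ℂ) (t s : ℝ) :
    Matrix (Fin n ⊕ Fin n) (Fin n ⊕ Fin n) ℂ :=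
  if s < t then ψ t * (χ s)ᴴ else φ t * (ζ s)ᴴ + (S.diracDelta t s : ℂ) • S.N t

/-- The integrand `s ↦ G(t, s, λ) A(s) f(s)`. -/
noncomputable def greenIntegrand (ψ φ χ ζ : ℝ → Matrix (Fin n ⊕ Fin n) (Fin n) ℂ)
    (f : ℝ → Fin n ⊕ Fin n → ℂ) (t s : ℝ) : Fin n ⊕ Fin n → ℂ :=
  S.green ψ φ χ ζ t s *ᵥ (S.A s *ᵥ f s)

/-- `(R_λ f)(t) = ∫_{t₀}^∞ G(t, s, λ) A(s) f(s) Δs`. -/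
noncomputable def greenOp (ψ φ χ ζ : ℝ → Matrix (Fin n ⊕ Fin n) (Fin n) ℂ)
    (f : ℝ → Fin n ⊕ Fin n → ℂ) (t : ℝ) : Fin n ⊕ Fin n → ℂ :=
  ∫ s, S.greenIntegrand ψ φ χ ζ f t s ∂S.vol

/-- `y` is a solution of `J ŷ^Δ = C y + A f` on `[t₀,∞)_X`, where `f` is merely measurable: `y` is
`A`-square integrable, `ŷ` is locally absolutely continuous, and the equation holds almost
everywhere and moreover at every point at which `A f` is continuous (in particular at every
isolated point, and at all points if `A f` is continuous). -/
def IsInhomogeneousSolution (C : ℝ → Matrix (Fin n ⊕ Fin n) (Fin n ⊕ Fin n) ℂ)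
    (f y : ℝ → Fin n ⊕ Fin n → ℂ) : Prop :=
  S.MemL2A y ∧ LocallyAC S.X S.t₀ (S.hat y) ∧
  (∀ᵐ t ∂S.vol, S.SolvesAt C (fun s => S.A s *ᵥ f s) y t) ∧
  (∀ t ∈ S.T, ContinuousWithinAt (fun s => S.A s *ᵥ f s) S.T t →
    S.SolvesAt C (fun s => S.A s *ᵥ f s) y t)

end HamiltonianSystem

/-! ### Sturmian half-lines -/

/-! Write C = λA + B, 𝒰 = 𝒰₂ₙ, and let P be the projection onto the second component. All calculus
is done on the shifted function u = ŷ. Since σ undoes ρ, the unshifted function is y = u + μ P u'.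
If K has zero diagonal blocks, that is P K + K P = K, the time-scale product rule for z* K u
involves only derivatives and unshifted functions. For K = J this yields the Lagrange identity Ẑ* J
Ŷ = J. For the Hermitian K = 𝒰J it yields the energy identity: Re u* 𝒰J u has density 2 Re y* 𝒰(C y
+ A f) along solutions of the inhomogeneous system.

Equation. Put F(t) = ∫_{t₀}^t χ* A f and H(t) = ∫_t^∞ ζ* A f. The shifted resolvent is ψ̂ F + φ̂ H =
Ŷ k with k = (I; M) F + (0; I) H and k' = -J Z* A f. Variation of constants
(`MatHasDensity.variation`) shows that Ŷ k solves the system, and that its unshifted version is Y k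
+ μ P V A f with V = (J - μ C P)⁻¹. A block computation gives μ P V = N, which is why the Green
matrix carries the term N δ.

Convergence. The bound defining Λ, transported by the inverse of 𝒰, makes the 𝒰⁻¹J-form of each
column of ζ̂ grow at least as fast as 2δ ζ* A ζ. Beyond t₁ this form is nonpositive: ψ̂ spans a
maximal nonpositive subspace for 𝒰J because M lies in the limiting Weyl set, ζ̂ is J-orthogonal to
it, and `re_form_nonpos_of_nonpos` dualises. Hence ζ is A-square integrable, H is well defined and
H(t) → 0.

Square integrability. For b ≥ t₁ the function R_λ f - φ H(b) solves the same equation, has zero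
energy at t₀, and at b its shifted version is ψ̂(b) F(b), whose energy is nonpositive. The bounds
from Λ and Λ̃ together with Young's inequality (`integral_re_form_le`) bound its A-norm on [t₀, b)
independently of b. Since H(b) → 0, Fatou's lemma finishes the argument.

The conditions involving J at t₀ and at infinity follow from the Lagrange identity; the almost
everywhere equation is Lebesgue differentiation transported to the time scale. -/

/-- The half-line `[t₀,∞)_X` of a closed set `X`, unbounded above, is Sturmian: the jump operators
are inverse to each other on it. -/
structure IsSturmian (X : Set ℝ) (t₀ : ℝ) : Prop where
  isClosed : IsClosed X
  unbounded : ¬ BddAbove X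
  mem : t₀ ∈ X
  jump : ∀ t ∈ tsIci X t₀,
    forwardJump X (backwardJump X t) = t ∧ backwardJump X (forwardJump X t) = t

namespace IsSturmian

variable {X : Set ℝ} {t₀ : ℝ}

theorem isClosed_tsIci (h : IsSturmian X t₀) : IsClosed (tsIci X t₀) :=
  h.isClosed.inter isClosed_Ici

theorem measurableSet_tsIci (h : IsSturmian X t₀) : MeasurableSet (tsIci X t₀) :=
  h.isClosed_tsIci.measurableSet

theorem isCompact_inter_Icc (h : IsSturmian X t₀) (b : ℝ) :
    IsCompact (tsIci X t₀ ∩ Set.Icc t₀ b) :=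
  isCompact_Icc.inter_left h.isClosed_tsIci

theorem left_mem (h : IsSturmian X t₀) : t₀ ∈ tsIci X t₀ := ⟨h.mem, Set.self_mem_Ici⟩

theorem nonempty_Ioi (h : IsSturmian X t₀) (t : ℝ) : (X ∩ Set.Ioi t).Nonempty := by
  have := h.unbounded
  rw [not_bddAbove_iff] at this
  obtain ⟨s, hs, hts⟩ := this t
  exact ⟨s, hs, hts⟩

theorem exists_ge (h : IsSturmian X t₀) (x : ℝ) : ∃ t ∈ tsIci X t₀, x ≤ t := by
  obtain ⟨s, hs, hts⟩ := h.nonempty_Ioi (max x t₀)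
  exact ⟨s, ⟨hs, (le_max_right _ _).trans (Set.mem_Ioi.1 hts).le⟩,
    (le_max_left _ _).trans (Set.mem_Ioi.1 hts).le⟩

theorem forwardJump_eq (h : IsSturmian X t₀) (t : ℝ) :
    forwardJump X t = sInf (X ∩ Set.Ioi t) := by
  simp [forwardJump, h.nonempty_Ioi t]

theorem le_forwardJump (h : IsSturmian X t₀) (t : ℝ) : t ≤ forwardJump X t := by
  rw [h.forwardJump_eq]
  exact le_csInf (h.nonempty_Ioi t) fun s hs => hs.2.le

theorem forwardJump_le (h : IsSturmian X t₀) {s t : ℝ} (hs : s ∈ X) (hts : t < s) :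
    forwardJump X t ≤ s := by
  rw [h.forwardJump_eq]
  exact csInf_le ⟨t, fun r hr => hr.2.le⟩ ⟨hs, hts⟩

theorem forwardJump_mem (h : IsSturmian X t₀) {t : ℝ} (ht : t ∈ tsIci X t₀) :
    forwardJump X t ∈ tsIci X t₀ := by
  refine ⟨?_, ht.2.trans (h.le_forwardJump t)⟩
  rw [h.forwardJump_eq]
  exact closure_minimal Set.inter_subset_left h.isClosed
    (csInf_mem_closure (h.nonempty_Ioi t) ⟨t, fun r hr => hr.2.le⟩)

theorem graininess_nonneg (h : IsSturmian X t₀) (t : ℝ) : 0 ≤ graininess X t :=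
  sub_nonneg.2 (h.le_forwardJump t)

theorem backwardJump_le (X : Set ℝ) (t : ℝ) : backwardJump X t ≤ t := by
  unfold backwardJump
  split_ifs with hne
  · exact csSup_le hne fun s hs => hs.2.le
  · exact le_rfl

theorem le_backwardJump {s t : ℝ} (hs : s ∈ X) (hst : s < t) : s ≤ backwardJump X t := by
  have hne : (X ∩ Set.Iio t).Nonempty := ⟨s, hs, hst⟩
  simp only [backwardJump, hne, if_true]
  exact le_csSup ⟨t, fun r hr => hr.2.le⟩ ⟨hs, hst⟩

theorem backwardJump_mem (h : IsSturmian X t₀) {t : ℝ} (ht : t ∈ X) : backwardJump X t ∈ X := by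
  unfold backwardJump
  split_ifs with hne
  · exact closure_minimal Set.inter_subset_left h.isClosed
      (csSup_mem_closure hne ⟨t, fun r hr => hr.2.le⟩)
  · exact ht

theorem backwardJump_mem_of_lt (h : IsSturmian X t₀) {t : ℝ} (ht : t ∈ tsIci X t₀)
    (hlt : t₀ < t) : backwardJump X t ∈ tsIci X t₀ :=
  ⟨h.backwardJump_mem ht.1, le_backwardJump h.mem hlt⟩

/-- If ρ(t) = t, then σ(ρ(t)) = t would force σ(t) = t. So a right-scattered point is isolated,
which is the practical content of the Sturmian condition. -/
theorem backwardJump_lt (h : IsSturmian X t₀) {t : ℝ} (ht : t ∈ tsIci X t₀)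
    (hd : t < forwardJump X t) : backwardJump X t < t := by
  refine lt_of_le_of_ne (backwardJump_le X t) fun he => ?_
  have := (h.jump t ht).1
  rw [he] at this
  exact hd.ne' this

theorem forwardJump_eq_or_lt (h : IsSturmian X t₀) (t : ℝ) :
    forwardJump X t = t ∨ t < forwardJump X t := by
  rcases (h.le_forwardJump t).eq_or_lt with he | hl
  exacts [Or.inl he.symm, Or.inr hl]

theorem nhdsWithin_eq_pure (h : IsSturmian X t₀) {t : ℝ} (ht : t ∈ tsIci X t₀)
    (hd : t < forwardJump X t) : 𝓝[tsIci X t₀] t = pure t := by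
  refine le_antisymm ?_ (pure_le_nhdsWithin ht)
  rw [le_pure_iff, mem_nhdsWithin]
  refine ⟨Set.Ioo (backwardJump X t) (forwardJump X t), isOpen_Ioo,
    ⟨h.backwardJump_lt ht hd, hd⟩, ?_⟩
  rintro s ⟨⟨h1, h2⟩, hs⟩
  rcases lt_trichotomy s t with hst | hst | hst
  · exact absurd (le_backwardJump hs.1 hst) (not_le.2 h1)
  · exact hst
  · exact absurd (h.forwardJump_le hs.1 hst) (not_le.2 h2)

theorem exists_mem_Ioo (h : IsSturmian X t₀) {t : ℝ} (ht : t ∈ tsIci X t₀)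
    (hd : forwardJump X t = t) {x : ℝ} (hx : t < x) : ∃ s ∈ tsIci X t₀, t < s ∧ s < x := by
  rw [h.forwardJump_eq] at hd
  obtain ⟨s, hs, hsx⟩ := exists_lt_of_csInf_lt (h.nonempty_Ioi t) (hd.trans_lt hx)
  exact ⟨s, ⟨hs.1, Set.mem_Ici.2 ((Set.mem_Ici.1 ht.2).trans (Set.mem_Ioi.1 hs.2).le)⟩, hs.2, hsx⟩

theorem eventually_tsIci_iff (t : ℝ) (p : ℝ → Prop) :
    (∀ᶠ s in 𝓝[tsIci X t₀] t, p s) ↔ ∃ η > 0, ∀ s ∈ tsIci X t₀, |s - t| < η → p s := by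
  rw [eventually_nhdsWithin_iff, Metric.eventually_nhds_iff]
  exact ⟨fun ⟨η, h1, h2⟩ => ⟨η, h1, fun s hs hst => h2 hst hs⟩,
    fun ⟨η, h1, h2⟩ => ⟨η, h1, fun s hst hs => h2 s hs hst⟩⟩

theorem continuousOn_forwardJump (h : IsSturmian X t₀) :
    ContinuousOn (forwardJump X) (tsIci X t₀) := by
  intro t ht
  rcases h.forwardJump_eq_or_lt t with hd | hd
  · rw [ContinuousWithinAt, hd, Metric.tendsto_nhds]
    intro ε hε
    obtain ⟨r, hr, htr, hrε⟩ := h.exists_mem_Ioo ht hd (lt_add_of_pos_right t hε)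
    rw [eventually_tsIci_iff]
    refine ⟨min (r - t) ε, lt_min (by linarith) hε, fun s hs hst => ?_⟩
    obtain ⟨h1, h2⟩ := lt_min_iff.1 hst
    rw [abs_lt] at h1 h2
    have h3 := h.le_forwardJump s
    have h4 : forwardJump X s ≤ r := h.forwardJump_le hr.1 (by linarith)
    rw [Real.dist_eq, abs_lt]
    constructor <;> linarith
  · rw [ContinuousWithinAt, h.nhdsWithin_eq_pure ht hd]
    exact tendsto_pure_nhds _ _

/-- Right-scattered points are isolated, so continuity can only fail at right-dense points, where
rd-continuity provides it. -/
theorem continuousOn_of_rdContinuous (h : IsSturmian X t₀) {E : Type*} [TopologicalSpace E]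
    {g : ℝ → E} (hg : RdContinuous X t₀ g) : ContinuousOn g (tsIci X t₀) := by
  intro t ht
  rcases h.forwardJump_eq_or_lt t with hd | hd
  · exact (hg t ht).1 hd
  · rw [ContinuousWithinAt, h.nhdsWithin_eq_pure ht hd]
    exact tendsto_pure_nhds _ _

/-- Induction on time scales for transitive relations: a relation that holds across every gap and
close to every dense point holds between any two points. -/
theorem rel_of_local (h : IsSturmian X t₀) {R : ℝ → ℝ → Prop} (hrefl : ∀ t ∈ tsIci X t₀, R t t)
    (htrans : ∀ r ∈ tsIci X t₀, ∀ s ∈ tsIci X t₀, ∀ t ∈ tsIci X t₀, r ≤ s → s ≤ t →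
      R r s → R s t → R r t)
    (hjump : ∀ t ∈ tsIci X t₀, t < forwardJump X t → R t (forwardJump X t))
    (hdense : ∀ t ∈ tsIci X t₀, forwardJump X t = t →
      ∀ᶠ s in 𝓝[tsIci X t₀] t, (s ≤ t → R s t) ∧ (t ≤ s → R t s))
    {a b : ℝ} (ha : a ∈ tsIci X t₀) (hb : b ∈ tsIci X t₀) (hab : a ≤ b) : R a b := by
  set D : Set ℝ := {r | r ∈ tsIci X t₀ ∧ a ≤ r ∧ r ≤ b ∧ R a r} with hD
  have haD : a ∈ D := ⟨ha, le_rfl, hab, hrefl a ha⟩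
  have hbdd : BddAbove D := ⟨b, fun r hr => hr.2.2.1⟩
  set c := sSup D with hc
  have hcT : c ∈ tsIci X t₀ := closure_minimal (fun r hr => hr.1) h.isClosed_tsIci
    (csSup_mem_closure ⟨a, haD⟩ hbdd)
  have hac : a ≤ c := le_csSup hbdd haD
  have hcb : c ≤ b := csSup_le ⟨a, haD⟩ fun r hr => hr.2.2.1
  -- Members of D come arbitrarily close to c from the left, or equal it, so any property holding
  -- near c holds at a member of D.
  have hev : ∀ p : ℝ → Prop, (∀ᶠ s in 𝓝[tsIci X t₀] c, p s) → ∃ s ∈ D, s ≤ c ∧ p s := by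
    intro p hp
    rw [eventually_tsIci_iff] at hp
    obtain ⟨η, hη, hp⟩ := hp
    obtain ⟨s, hs, hcs⟩ := exists_lt_of_lt_csSup ⟨a, haD⟩ (sub_lt_self c hη)
    have hsc : s ≤ c := le_csSup hbdd hs
    refine ⟨s, hs, hsc, hp s hs.1 ?_⟩
    rw [abs_lt]
    constructor <;> linarith
  have hRc : R a c := by
    rcases h.forwardJump_eq_or_lt c with hd | hd
    · obtain ⟨s, hs, hsc, hp⟩ := hev _ (hdense c hcT hd)
      exact htrans a ha s hs.1 c hcT hs.2.1 hsc hs.2.2.2 (hp.1 hsc)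
    · obtain ⟨s, hs, hsc, hp⟩ := hev (fun s => s = c) (by
        rw [h.nhdsWithin_eq_pure hcT hd]; exact eventually_pure.2 rfl)
      exact hp ▸ hs.2.2.2
  rcases hcb.eq_or_lt with he | hlt
  · exact he ▸ hRc
  exfalso
  -- If c < b, the relation cannot be continued past the supremum c; a gap or a dense point at c
  -- each contradicts this.
  have hnot : ∀ s ∈ tsIci X t₀, c < s → s ≤ b → ¬ R c s := fun s hs hcs hsb hR =>
    absurd (le_csSup hbdd ⟨hs, hac.trans hcs.le, hsb, htrans a ha c hcT s hs hac hcs.le hRc hR⟩)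
      (not_le.2 hcs)
  rcases h.forwardJump_eq_or_lt c with hd | hd
  · have hdc := hdense c hcT hd
    rw [eventually_tsIci_iff] at hdc
    obtain ⟨η, hη, hp⟩ := hdc
    obtain ⟨s, hs, hcs, hsx⟩ := h.exists_mem_Ioo hcT hd
      (lt_min hlt (lt_add_of_pos_right c hη))
    obtain ⟨h1, h2⟩ := lt_min_iff.1 hsx
    exact hnot s hs hcs h1.le ((hp s hs (by rw [abs_lt]; constructor <;> linarith)).2 hcs.le)
  · exact hnot _ (h.forwardJump_mem hcT) hd (h.forwardJump_le hb.1 hlt) (hjump c hcT hd)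

/-! ### The delta measure -/

theorem sSup_le_self (h : IsSturmian X t₀) {x : ℝ} (hx : t₀ ≤ x) : sSup (X ∩ Set.Iic x) ≤ x :=
  csSup_le ⟨t₀, h.mem, hx⟩ fun _ hr => hr.2

/-- Galois connection between the inclusion of X and the retraction x ↦ max {s ∈ X : s ≤ x};
computations with the pushforward measure go through it. -/
theorem le_sSup_iff (h : IsSturmian X t₀) {x s : ℝ} (hx : t₀ ≤ x) (hs : s ∈ X) :
    s ≤ sSup (X ∩ Set.Iic x) ↔ s ≤ x :=
  ⟨fun hle => hle.trans (h.sSup_le_self hx), fun hle => le_csSup ⟨x, fun _ hr => hr.2⟩ ⟨hs, hle⟩⟩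

theorem sSup_mem (h : IsSturmian X t₀) {x : ℝ} (hx : t₀ ≤ x) :
    sSup (X ∩ Set.Iic x) ∈ tsIci X t₀ :=
  ⟨closure_minimal Set.inter_subset_left h.isClosed
    (csSup_mem_closure ⟨t₀, h.mem, hx⟩ ⟨x, fun _ hr => hr.2⟩), (h.le_sSup_iff hx h.mem).2 hx⟩

theorem aemeasurable_sSup (h : IsSturmian X t₀) :
    AEMeasurable (fun x => sSup (X ∩ Set.Iic x)) (volume.restrict (Set.Ici t₀)) := by
  refine aemeasurable_restrict_of_monotoneOn measurableSet_Ici fun x hx y hy hxy => ?_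
  exact (h.le_sSup_iff hy (h.sSup_mem hx).1).2 ((h.sSup_le_self hx).trans hxy)

theorem deltaMeasure_apply (h : IsSturmian X t₀) {s : Set ℝ} (hs : MeasurableSet s) :
    deltaMeasure X t₀ s = volume ((fun x => sSup (X ∩ Set.Iic x)) ⁻¹' s ∩ Set.Ici t₀) := by
  rw [deltaMeasure, Measure.map_apply_of_aemeasurable h.aemeasurable_sSup hs,
    Measure.restrict_apply' measurableSet_Ici]

theorem deltaMeasure_compl (h : IsSturmian X t₀) : deltaMeasure X t₀ (tsIci X t₀)ᶜ = 0 := by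
  rw [h.deltaMeasure_apply h.measurableSet_tsIci.compl]
  convert measure_empty (μ := volume)
  ext x
  simp only [Set.mem_inter_iff, Set.mem_preimage, Set.mem_compl_iff, Set.mem_Ici,
    Set.mem_empty_iff_false, iff_false, not_and]
  exact fun hx hx' => hx (h.sSup_mem hx')

theorem ae_mem (h : IsSturmian X t₀) : ∀ᵐ t ∂(deltaMeasure X t₀), t ∈ tsIci X t₀ :=
  h.deltaMeasure_compl

theorem restrict_inter (h : IsSturmian X t₀) (s : Set ℝ) :
    (deltaMeasure X t₀).restrict (s ∩ tsIci X t₀) = (deltaMeasure X t₀).restrict s := by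
  refine Measure.restrict_congr_set ?_
  filter_upwards [h.ae_mem] with t ht
  exact propext ⟨fun hx => hx.1, fun hx => ⟨hx, ht⟩⟩

theorem restrict_tsIci (h : IsSturmian X t₀) :
    (deltaMeasure X t₀).restrict (tsIci X t₀) = deltaMeasure X t₀ := by
  simpa using h.restrict_inter Set.univ

theorem preimage_Ico (h : IsSturmian X t₀) {a b : ℝ} (ha : a ∈ tsIci X t₀)
    (hb : b ∈ tsIci X t₀) :
    (fun x => sSup (X ∩ Set.Iic x)) ⁻¹' Set.Ico a b ∩ Set.Ici t₀ = Set.Ico a b := by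
  ext x
  simp only [Set.mem_inter_iff, Set.mem_preimage, Set.mem_Ico, Set.mem_Ici]
  constructor
  · rintro ⟨⟨h1, h2⟩, h3⟩
    rw [h.le_sSup_iff h3 ha.1] at h1
    rw [← not_le, h.le_sSup_iff h3 hb.1, not_le] at h2
    exact ⟨h1, h2⟩
  · rintro ⟨h1, h2⟩
    have h3 : t₀ ≤ x := le_trans ha.2 h1
    exact ⟨⟨(h.le_sSup_iff h3 ha.1).2 h1, (h.sSup_le_self h3).trans_lt h2⟩, h3⟩

theorem deltaMeasure_Ico (h : IsSturmian X t₀) {a b : ℝ} (ha : a ∈ tsIci X t₀)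
    (hb : b ∈ tsIci X t₀) : deltaMeasure X t₀ (Set.Ico a b) = ENNReal.ofReal (b - a) := by
  rw [h.deltaMeasure_apply measurableSet_Ico, h.preimage_Ico ha hb, Real.volume_Ico]

theorem deltaMeasure_Ico_lt_top (h : IsSturmian X t₀) (a b : ℝ) :
    deltaMeasure X t₀ (Set.Ico a b) < ⊤ := by
  obtain ⟨c, hc, hbc⟩ := h.exists_ge b
  refine (measure_mono_ae ?_).trans_lt (h.deltaMeasure_Ico h.left_mem hc ▸ ENNReal.ofReal_lt_top)
  filter_upwards [h.ae_mem] with t ht htab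
  exact ⟨ht.2, htab.2.trans_le hbc⟩

theorem Ico_forwardJump_inter (h : IsSturmian X t₀) {t : ℝ} (ht : t ∈ tsIci X t₀)
    (hd : t < forwardJump X t) : Set.Ico t (forwardJump X t) ∩ tsIci X t₀ = {t} := by
  ext s
  constructor
  · rintro ⟨⟨h1, h2⟩, hs⟩
    rcases h1.eq_or_lt with he | hl
    · exact he.symm
    · exact absurd (h.forwardJump_le hs.1 hl) (not_le.2 h2)
  · rintro rfl
    exact ⟨⟨le_rfl, hd⟩, ht⟩

/-- At a right-scattered t the interval meets the time scale only in t, an atom of mass μ(t); at a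
right-dense t both sides vanish. -/
theorem setIntegral_Ico_forwardJump (h : IsSturmian X t₀) {E : Type*} [NormedAddCommGroup E]
    [NormedSpace ℝ E] [CompleteSpace E] {t : ℝ} (ht : t ∈ tsIci X t₀) (g : ℝ → E) :
    ∫ s in Set.Ico t (forwardJump X t), g s ∂(deltaMeasure X t₀) = graininess X t • g t := by
  rcases h.forwardJump_eq_or_lt t with hd | hd
  · simp [graininess, hd]
  · have h1 : (deltaMeasure X t₀) {t} = ENNReal.ofReal (graininess X t) := by
      rw [← h.Ico_forwardJump_inter ht hd, graininess,
        ← h.deltaMeasure_Ico ht (h.forwardJump_mem ht)]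
      refine measure_congr ?_
      filter_upwards [h.ae_mem] with s hs
      exact propext ⟨fun hx => hx.1, fun hx => ⟨hx, hs⟩⟩
    rw [← h.restrict_inter, h.Ico_forwardJump_inter ht hd, integral_singleton,
      Measure.real, h1, ENNReal.toReal_ofReal (h.graininess_nonneg t)]

theorem aestronglyMeasurable_of_continuousOn (h : IsSturmian X t₀) {E : Type*}
    [TopologicalSpace E] [TopologicalSpace.PseudoMetrizableSpace E] {g : ℝ → E}
    (hg : ContinuousOn g (tsIci X t₀)) : AEStronglyMeasurable g (deltaMeasure X t₀) := by
  rw [← h.restrict_tsIci]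
  exact hg.aestronglyMeasurable h.measurableSet_tsIci

theorem integrableOn_of_continuousOn (h : IsSturmian X t₀) {E : Type*} [NormedAddCommGroup E]
    {g : ℝ → E} (hg : ContinuousOn g (tsIci X t₀)) (b : ℝ) :
    IntegrableOn g (Set.Ico t₀ b) (deltaMeasure X t₀) := by
  obtain ⟨C, hC⟩ := (h.isCompact_inter_Icc b).exists_bound_of_continuousOn
    (hg.mono Set.inter_subset_left)
  refine IntegrableOn.of_bound (C := C) (h.deltaMeasure_Ico_lt_top t₀ b)
    (h.aestronglyMeasurable_of_continuousOn hg).restrict ?_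
  rw [← h.restrict_inter]
  filter_upwards [ae_restrict_mem (measurableSet_Ico.inter h.measurableSet_tsIci)] with t ht
  exact hC t ⟨ht.2, ht.1.1, ht.1.2.le⟩

theorem integrableOn_mul_of_continuousOn (h : IsSturmian X t₀) {g v : ℝ → ℂ} {b : ℝ}
    (hg : IntegrableOn g (Set.Ico t₀ b) (deltaMeasure X t₀))
    (hv : ContinuousOn v (tsIci X t₀)) :
    IntegrableOn (fun t => g t * v t) (Set.Ico t₀ b) (deltaMeasure X t₀) := by
  rw [IntegrableOn, ← h.restrict_inter] at hg ⊢
  exact IntegrableOn.mul_continuousOn_of_subset hg (hv.mono Set.inter_subset_left)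
    (measurableSet_Ico.inter h.measurableSet_tsIci) (h.isCompact_inter_Icc b)
    fun t ht => ⟨ht.2, ht.1.1, ht.1.2.le⟩

end IsSturmian

/-! ### Functions with a density -/

/-- `u` is a primitive on `[t₀,∞)_X` of the locally integrable function `u'`. -/
def HasDensity {E : Type*} [NormedAddCommGroup E] [NormedSpace ℝ E] (X : Set ℝ) (t₀ : ℝ)
    (u u' : ℝ → E) : Prop :=
  (∀ b, IntegrableOn u' (Set.Ico t₀ b) (deltaMeasure X t₀)) ∧
  ∀ s ∈ tsIci X t₀, ∀ t ∈ tsIci X t₀, s ≤ t →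
    ∫ r in Set.Ico s t, u' r ∂(deltaMeasure X t₀) = u t - u s

section Density

variable {X : Set ℝ} {t₀ : ℝ} {E : Type*} [NormedAddCommGroup E] [NormedSpace ℝ E]

theorem integrableOn_Ico_of_mem {F : Type*} [NormedAddCommGroup F] {g : ℝ → F} {μ : Measure ℝ}
    {s t : ℝ} (hg : IntegrableOn g (Set.Ico t₀ t) μ) (hs : s ∈ tsIci X t₀) :
    IntegrableOn g (Set.Ico s t) μ :=
  hg.mono_set (Set.Ico_subset_Ico_left hs.2)

theorem setIntegral_Ico_add {g : ℝ → E} {μ : Measure ℝ}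
    (hg : ∀ b, IntegrableOn g (Set.Ico t₀ b) μ) {r s t : ℝ} (hr : r ∈ tsIci X t₀)
    (hs : s ∈ tsIci X t₀) (hrs : r ≤ s) (hst : s ≤ t) :
    ∫ x in Set.Ico r t, g x ∂μ = ∫ x in Set.Ico r s, g x ∂μ + ∫ x in Set.Ico s t, g x ∂μ := by
  rw [← Set.Ico_union_Ico_eq_Ico hrs hst]
  refine setIntegral_union ?_ measurableSet_Ico (integrableOn_Ico_of_mem (hg s) hr)
    (integrableOn_Ico_of_mem (hg t) hs)
  rw [Set.disjoint_left]
  exact fun x hx hx' => absurd hx.2 (not_lt.2 hx'.1)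

namespace HasDensity

theorem integrableOn {u u' : ℝ → E} (hu : HasDensity X t₀ u u') {s : ℝ}
    (hs : s ∈ tsIci X t₀) (t : ℝ) : IntegrableOn u' (Set.Ico s t) (deltaMeasure X t₀) :=
  integrableOn_Ico_of_mem (hu.1 t) hs

theorem congr {u v u' v' : ℝ → E} (h : IsSturmian X t₀) (hu : HasDensity X t₀ u u')
    (huv : ∀ t ∈ tsIci X t₀, u t = v t) (huv' : ∀ t ∈ tsIci X t₀, u' t = v' t) :
    HasDensity X t₀ v v' := by
  have hae : ∀ s, u' =ᵐ[(deltaMeasure X t₀).restrict s] v' := fun s =>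
    ae_restrict_of_ae (h.ae_mem.mono huv')
  refine ⟨fun b => (hu.1 b).congr (hae _), fun s hs t ht hst => ?_⟩
  rw [← huv s hs, ← huv t ht, ← hu.2 s hs t ht hst]
  exact integral_congr_ae (hae _).symm

theorem const (c : E) : HasDensity X t₀ (fun _ => c) (fun _ => 0) :=
  ⟨fun b => integrableOn_zero, fun s _ t _ _ => by simp⟩

theorem add {u u' v v' : ℝ → E} (hu : HasDensity X t₀ u u') (hv : HasDensity X t₀ v v') :
    HasDensity X t₀ (fun t => u t + v t) (fun t => u' t + v' t) := by
  refine ⟨fun b => (hu.1 b).add (hv.1 b), fun s hs t ht hst => ?_⟩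
  rw [integral_add (hu.integrableOn hs t) (hv.integrableOn hs t), hu.2 s hs t ht hst,
    hv.2 s hs t ht hst, sub_add_sub_comm]

theorem sum {ι : Type*} [Fintype ι] {u u' : ι → ℝ → E}
    (hu : ∀ i, HasDensity X t₀ (u i) (u' i)) :
    HasDensity X t₀ (fun t => ∑ i, u i t) (fun t => ∑ i, u' i t) := by
  refine ⟨fun b => integrable_finsetSum _ fun i _ => (hu i).1 b, fun s hs t ht hst => ?_⟩
  rw [integral_finsetSum _ fun i _ => (hu i).integrableOn hs t, ← Finset.sum_sub_distrib]
  exact Finset.sum_congr rfl fun i _ => (hu i).2 s hs t ht hst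

theorem clm_comp [CompleteSpace E] {F : Type*} [NormedAddCommGroup F] [NormedSpace ℝ F]
    [CompleteSpace F] (L : E →L[ℝ] F) {u u' : ℝ → E} (hu : HasDensity X t₀ u u') :
    HasDensity X t₀ (fun t => L (u t)) (fun t => L (u' t)) := by
  refine ⟨fun b => L.integrable_comp (hu.1 b), fun s hs t ht hst => ?_⟩
  rw [L.integral_comp_comm (hu.integrableOn hs t), hu.2 s hs t ht hst, map_sub]

theorem pi {ι : Type*} [Fintype ι] {u u' : ℝ → ι → ℂ}
    (hu : ∀ i, HasDensity X t₀ (fun t => u t i) (fun t => u' t i)) : HasDensity X t₀ u u' := by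
  have hint : ∀ b, IntegrableOn u' (Set.Ico t₀ b) (deltaMeasure X t₀) := fun b =>
    Integrable.of_eval fun i => (hu i).1 b
  refine ⟨hint, fun s hs t ht hst => ?_⟩
  ext i
  rw [eval_integral fun i => (hu i).integrableOn hs t]
  exact (hu i).2 s hs t ht hst

theorem primitive {g : ℝ → E} (h : IsSturmian X t₀)
    (hg : ∀ b, IntegrableOn g (Set.Ico t₀ b) (deltaMeasure X t₀)) :
    HasDensity X t₀ (fun t => ∫ r in Set.Ico t₀ t, g r ∂(deltaMeasure X t₀)) g :=
  ⟨hg, fun s hs t _ hst => by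
    dsimp only
    rw [setIntegral_Ico_add hg h.left_mem hs hs.2 hst, add_sub_cancel_left]⟩

theorem eq_add [CompleteSpace E] {u u' : ℝ → E} (h : IsSturmian X t₀) (hu : HasDensity X t₀ u u')
    {t : ℝ} (ht : t ∈ tsIci X t₀) : u (forwardJump X t) = u t + graininess X t • u' t := by
  have := hu.2 t ht _ (h.forwardJump_mem ht) (h.le_forwardJump t)
  rw [h.setIntegral_Ico_forwardJump ht] at this
  rw [this, add_sub_cancel]

theorem locallyAC {u u' : ℝ → E} (h : IsSturmian X t₀) (hu : HasDensity X t₀ u u') :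
    LocallyAC X t₀ u := by
  intro b hb ε hε
  set ν := deltaMeasure X t₀ with hν
  have hfin : ∫⁻ r in Set.Ico t₀ b, ‖u' r‖ₑ ∂ν ≠ ⊤ := (hu.1 b).2.ne
  obtain ⟨δ, hδ, hsmall⟩ := exists_pos_setLIntegral_lt_of_measure_lt hfin
    (ENNReal.ofReal_pos.2 hε).ne'
  -- The threshold from absolute continuity of the integral lives in the extended reals and may be
  -- infinite.
  obtain ⟨δ', hδ'0, hδ'⟩ : ∃ δ' : ℝ, 0 < δ' ∧ ENNReal.ofReal δ' ≤ δ := by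
    rcases eq_or_ne δ ⊤ with rfl | hne
    · exact ⟨1, one_pos, le_top⟩
    · exact ⟨δ.toReal, ENNReal.toReal_pos hδ.ne' hne, ENNReal.ofReal_toReal_le⟩
  refine ⟨δ', hδ'0, fun N a c hac hdisj hsum => ?_⟩
  set s : Set ℝ := ⋃ k, Set.Ico (a k) (c k) with hs
  have hsub : s ⊆ Set.Ico t₀ b := Set.iUnion_subset fun k =>
    Set.Ico_subset_Ico (hac k).1.2 (hac k).2.2.2
  have hmeas : ∀ k, MeasurableSet (Set.Ico (a k) (c k)) := fun k => measurableSet_Ico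
  have hνs : (ν.restrict (Set.Ico t₀ b)) s < δ := by
    refine lt_of_le_of_lt (Measure.restrict_apply_le _ _) (lt_of_lt_of_le ?_ hδ')
    rw [hs, measure_iUnion hdisj hmeas, tsum_fintype]
    simp_rw [hν, h.deltaMeasure_Ico (hac _).1 (hac _).2.1]
    rw [← ENNReal.ofReal_sum_of_nonneg fun k _ => sub_nonneg.2 (hac k).2.2.1]
    exact (ENNReal.ofReal_lt_ofReal_iff hδ'0).2 hsum
  have hlt := hsmall s hνs
  rw [Measure.restrict_restrict_of_subset hsub, hs, lintegral_iUnion hmeas hdisj,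
    tsum_fintype] at hlt
  have hle : ∀ k, ENNReal.ofReal ‖u (c k) - u (a k)‖ ≤ ∫⁻ r in Set.Ico (a k) (c k), ‖u' r‖ₑ ∂ν :=
    fun k => by
      rw [← hu.2 _ (hac k).1 _ (hac k).2.1 (hac k).2.2.1, ofReal_norm]
      exact enorm_integral_le_lintegral_enorm _
  have := (Finset.sum_le_sum fun k _ => hle k).trans_lt hlt
  rwa [← ENNReal.ofReal_sum_of_nonneg fun k _ => norm_nonneg _,
    ENNReal.ofReal_lt_ofReal_iff hε] at this

end HasDensity

theorem LocallyAC.continuousOn {F : Type*} [NormedAddCommGroup F] {u : ℝ → F}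
    (h : IsSturmian X t₀) (hu : LocallyAC X t₀ u) :
    ContinuousOn u (tsIci X t₀) := by
  intro t ht
  rw [ContinuousWithinAt, Metric.tendsto_nhds]
  intro ε hε
  obtain ⟨b, hb, htb⟩ := h.exists_ge (t + 1)
  obtain ⟨δ, hδ, hsmall⟩ := hu b hb ε hε
  rw [IsSturmian.eventually_tsIci_iff]
  refine ⟨min δ 1, lt_min hδ one_pos, fun s hs hst => ?_⟩
  obtain ⟨h1, h2⟩ := lt_min_iff.1 hst
  rw [abs_lt] at h1 h2
  have key : ∀ x ∈ tsIci X t₀, ∀ y ∈ tsIci X t₀, x ≤ y → y ≤ b → y - x < δ →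
      ‖u y - u x‖ < ε := fun x hx y hy hxy hyb hlt => by
    simpa using hsmall 1 (fun _ => x) (fun _ => y) (fun _ => ⟨hx, hy, hxy, hyb⟩)
      (fun k l hkl => absurd (Subsingleton.elim k l) hkl) (by simpa using hlt)
  rcases le_total s t with hle | hle
  · rw [dist_comm, dist_eq_norm]
    exact key s hs t ht hle (by linarith) (by linarith)
  · rw [dist_eq_norm]
    exact key t ht s hs hle (by linarith) (by linarith)

theorem HasDensity.continuousOn {u u' : ℝ → E} (h : IsSturmian X t₀) (hu : HasDensity X t₀ u u') :
    ContinuousOn u (tsIci X t₀) :=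
  (hu.locallyAC h).continuousOn h

/-- Product rule. -/
theorem HasDensity.mul {u u' v v' : ℝ → ℂ} (h : IsSturmian X t₀) (hu : HasDensity X t₀ u u')
    (hv : HasDensity X t₀ v v') :
    HasDensity X t₀ (fun t => u t * v t)
      (fun t => u' t * v (forwardJump X t) + u t * v' t) := by
  have huc := hu.continuousOn h
  have hvc := hv.continuousOn h
  have hvσ : ContinuousOn (fun t => v (forwardJump X t)) (tsIci X t₀) :=
    hvc.comp h.continuousOn_forwardJump fun t ht => h.forwardJump_mem ht
  set ν := deltaMeasure X t₀ with hν
  set D : ℝ → ℂ := fun t => u' t * v (forwardJump X t) + u t * v' t with hD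
  have hDint : ∀ b, IntegrableOn D (Set.Ico t₀ b) ν := fun b => by
    refine (h.integrableOn_mul_of_continuousOn (hu.1 b) hvσ).add ?_
    simpa only [mul_comm (u _)] using h.integrableOn_mul_of_continuousOn (hv.1 b) huc
  refine ⟨hDint, fun s hs t ht hst => ?_⟩
  set w : ℝ → ℝ := fun r => ‖u' r‖ + ‖v' r‖ with hw
  have hwint : ∀ b, IntegrableOn w (Set.Ico t₀ b) ν := fun b => (hu.1 b).norm.add (hv.1 b).norm
  have hwnn : ∀ r, 0 ≤ w r := fun r => by positivity
  have hwI : ∀ s t, 0 ≤ ∫ r in Set.Ico s t, w r ∂ν := fun s t => integral_nonneg hwnn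
  -- The error is additive over adjacent intervals and so is the bound ε ∫ w; hence it suffices to
  -- check gaps, where the error is exactly zero, and neighbourhoods of dense points.
  have main : ∀ ε > 0, ‖∫ r in Set.Ico s t, D r ∂ν - (u t * v t - u s * v s)‖
      ≤ ε * ∫ r in Set.Ico s t, w r ∂ν := by
    intro ε hε
    refine h.rel_of_local (R := fun s t => ‖∫ r in Set.Ico s t, D r ∂ν - (u t * v t - u s * v s)‖
      ≤ ε * ∫ r in Set.Ico s t, w r ∂ν) (fun t _ => by simp) ?_ ?_ ?_ hs ht hst
    · intro r hr s hs t ht hrs hst h1 h2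
      rw [setIntegral_Ico_add hDint hr hs hrs hst, setIntegral_Ico_add hwint hr hs hrs hst, mul_add]
      refine le_trans (le_of_eq ?_) ((norm_add_le _ _).trans (add_le_add h1 h2))
      congr 1
      ring
    · intro t ht hd
      rw [h.setIntegral_Ico_forwardJump ht]
      refine le_trans (le_of_eq ?_) (mul_nonneg hε.le (hwI _ _))
      rw [norm_eq_zero, hD]
      have h1 := hu.eq_add h ht
      have h2 := hv.eq_add h ht
      simp only [Complex.real_smul] at h1 h2 ⊢
      rw [h1, h2]
      ring
    · intro c hc hd
      have key : ∃ η > 0, ∀ r ∈ tsIci X t₀, |r - c| < η → ‖u r - u c‖ < ε / 2 ∧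
          ‖v r - v c‖ < ε / 2 ∧ ‖v (forwardJump X r) - v c‖ < ε / 2 := by
        rw [← IsSturmian.eventually_tsIci_iff]
        have e1 := Metric.tendsto_nhds.1 (huc c hc) (ε / 2) (half_pos hε)
        have e2 := Metric.tendsto_nhds.1 (hvc c hc) (ε / 2) (half_pos hε)
        have e3 := Metric.tendsto_nhds.1 (hvσ c hc) (ε / 2) (half_pos hε)
        simp only [dist_eq_norm, hd] at e1 e2 e3
        filter_upwards [e1, e2, e3] with r h1 h2 h3 using ⟨h1, h2, h3⟩
      obtain ⟨η, hη, key⟩ := key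
      have fin : ∀ s ∈ tsIci X t₀, ∀ t ∈ tsIci X t₀, s ≤ t → |s - c| < η → |t - c| < η →
          ‖∫ r in Set.Ico s t, D r ∂ν - (u t * v t - u s * v s)‖
            ≤ ε * ∫ r in Set.Ico s t, w r ∂ν := by
        intro s hs t ht hst hsc htc
        -- Freezing v at the right end and u at the left end makes the increment an exact integral;
        -- near a dense point the frozen factors differ from the true ones by at most ε.
        have e : u t * v t - u s * v s =
            ∫ r in Set.Ico s t, (u' r * v t + u s * v' r) ∂ν := by
          rw [integral_add ((hu.integrableOn hs t).mul_const _)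
            ((hv.integrableOn hs t).const_mul _), integral_mul_const, integral_const_mul,
            hu.2 s hs t ht hst, hv.2 s hs t ht hst]
          ring
        have hi : IntegrableOn (fun r => u' r * v t + u s * v' r) (Set.Ico s t) ν :=
          ((hu.integrableOn hs t).mul_const _).add ((hv.integrableOn hs t).const_mul _)
        rw [e, ← integral_sub (integrableOn_Ico_of_mem (hDint t) hs) hi, ← integral_const_mul]
        refine norm_integral_le_of_norm_le ((integrableOn_Ico_of_mem (hwint t) hs).const_mul ε) ?_
        filter_upwards [ae_restrict_mem measurableSet_Ico, ae_restrict_of_ae h.ae_mem]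
          with r hr hrT
        have hrc : |r - c| < η := by
          rw [abs_lt] at hsc htc ⊢
          constructor <;> linarith [hr.1, hr.2]
        obtain ⟨a1, _, a3⟩ := key r hrT hrc
        obtain ⟨b1, _, _⟩ := key s hs hsc
        obtain ⟨_, c2, _⟩ := key t ht htc
        have d1 : ‖v (forwardJump X r) - v t‖ ≤ ε := by
          have := norm_sub_le (v (forwardJump X r) - v c) (v t - v c)
          rw [sub_sub_sub_cancel_right] at this
          linarith
        have d2 : ‖u r - u s‖ ≤ ε := by
          have := norm_sub_le (u r - u c) (u s - u c)
          rw [sub_sub_sub_cancel_right] at this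
          linarith
        have e2 : D r - (u' r * v t + u s * v' r) =
            u' r * (v (forwardJump X r) - v t) + (u r - u s) * v' r := by
          simp only [hD]; ring
        rw [e2]
        refine (norm_add_le _ _).trans ?_
        rw [norm_mul, norm_mul, hw]
        nlinarith [norm_nonneg (u' r), norm_nonneg (v' r)]
      rw [IsSturmian.eventually_tsIci_iff]
      refine ⟨η, hη, fun s hs hsc => ⟨fun hle => fin s hs c hc hle hsc (by simpa using hη),
        fun hle => fin c hc s hs hle (by simpa using hη) hsc⟩⟩
  have hlim : ‖∫ r in Set.Ico s t, D r ∂ν - (u t * v t - u s * v s)‖ ≤ 0 := by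
    refine le_of_forall_pos_le_add fun ε hε => ?_
    -- The added 1 keeps the divisor positive when the integral of w is zero.
    have h1 := main (ε / (∫ r in Set.Ico s t, w r ∂ν + 1)) (div_pos hε (by linarith [hwI s t]))
    rw [zero_add]
    refine h1.trans ?_
    rw [div_mul_eq_mul_div, div_le_iff₀ (by linarith [hwI s t])]
    nlinarith [hwI s t]
  exact sub_eq_zero.1 (norm_le_zero_iff.1 hlim)

/-! ### Densities and delta derivatives. -/

theorem eventually_norm_setIntegral_sub_le [CompleteSpace E] (h : IsSturmian X t₀) {g : ℝ → E}
    (hg : ∀ b, IntegrableOn g (Set.Ico t₀ b) (deltaMeasure X t₀)) {c : ℝ}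
    (hgc : ContinuousWithinAt g (tsIci X t₀) c) (hc : c ∈ tsIci X t₀) {ε : ℝ} (hε : 0 < ε) :
    ∀ᶠ s in 𝓝[tsIci X t₀] c,
      (s ≤ c → ‖∫ r in Set.Ico s c, g r ∂(deltaMeasure X t₀) - (c - s) • g c‖ ≤ ε * (c - s)) ∧
      (c ≤ s → ‖∫ r in Set.Ico c s, g r ∂(deltaMeasure X t₀) - (s - c) • g c‖ ≤ ε * (s - c)) := by
  obtain ⟨η, hη, key⟩ := (IsSturmian.eventually_tsIci_iff c _).1
    (Metric.tendsto_nhds.1 hgc ε hε)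
  have fin : ∀ s ∈ tsIci X t₀, ∀ t ∈ tsIci X t₀, s ≤ t → |s - c| < η → |t - c| < η →
      ‖∫ r in Set.Ico s t, g r ∂(deltaMeasure X t₀) - (t - s) • g c‖ ≤ ε * (t - s) := by
    intro s hs t ht hst hsc htc
    have hm : (deltaMeasure X t₀).real (Set.Ico s t) = t - s := by
      rw [Measure.real, h.deltaMeasure_Ico hs ht, ENNReal.toReal_ofReal (sub_nonneg.2 hst)]
    have e : (t - s) • g c = ∫ _ in Set.Ico s t, g c ∂(deltaMeasure X t₀) := by
      rw [setIntegral_const, hm]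
    rw [e, ← integral_sub (integrableOn_Ico_of_mem (hg t) hs)
      (integrableOn_const (C := g c) (h.deltaMeasure_Ico_lt_top s t).ne), ← hm]
    refine norm_setIntegral_le_of_norm_le_const_ae (h.deltaMeasure_Ico_lt_top s t) ?_
    filter_upwards [ae_restrict_mem measurableSet_Ico, ae_restrict_of_ae h.ae_mem] with r hr hrT
    have hrc : |r - c| < η := by
      rw [abs_lt] at hsc htc ⊢
      constructor <;> linarith [hr.1, hr.2]
    rw [← dist_eq_norm]
    exact (key r hrT hrc).le
  rw [IsSturmian.eventually_tsIci_iff]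
  exact ⟨η, hη, fun s hs hsc => ⟨fun hle => fin s hs c hc hle hsc (by simpa using hη),
    fun hle => fin c hc s hs hle (by simpa using hη) hsc⟩⟩

/-- The neighbourhoods in the delta derivative are not punctured, so s = t is allowed; there the
little-o bound holds with every constant and the error vanishes. -/
theorem HasDeltaDerivAt.eq_add {u : ℝ → E} {d : E} {t : ℝ} (ht : t ∈ tsIci X t₀)
    (hu : HasDeltaDerivAt X t₀ u d t) : u (forwardJump X t) = u t + graininess X t • d := by
  have key : ∀ c > 0, ‖u (forwardJump X t) - u t - (forwardJump X t - t) • d‖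
      ≤ c * ‖forwardJump X t - t‖ := fun c hc =>
    (Asymptotics.IsLittleO.def hu hc).self_of_nhdsWithin ht
  have hlim : ‖u (forwardJump X t) - u t - (forwardJump X t - t) • d‖ ≤ 0 := by
    refine le_of_forall_pos_le_add fun ε hε => ?_
    refine (key (ε / (‖forwardJump X t - t‖ + 1)) (by positivity)).trans ?_
    rw [zero_add, div_mul_eq_mul_div, div_le_iff₀ (by positivity)]
    nlinarith [norm_nonneg (forwardJump X t - t)]
  have := norm_le_zero_iff.1 hlim
  rw [sub_sub, sub_eq_zero] at this
  exact this

theorem hasDeltaDerivAt_of_lt {u : ℝ → E} {d : E} {t : ℝ} (h : IsSturmian X t₀)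
    (ht : t ∈ tsIci X t₀) (hd : t < forwardJump X t)
    (hu : u (forwardJump X t) = u t + graininess X t • d) : HasDeltaDerivAt X t₀ u d t := by
  rw [HasDeltaDerivAt, h.nhdsWithin_eq_pure ht hd, Asymptotics.isLittleO_pure, hu, graininess]
  simp

theorem HasDeltaDerivAt.continuousWithinAt {u : ℝ → E} {d : E} {t : ℝ} (h : IsSturmian X t₀)
    (ht : t ∈ tsIci X t₀) (hu : HasDeltaDerivAt X t₀ u d t) :
    ContinuousWithinAt u (tsIci X t₀) t := by
  rcases h.forwardJump_eq_or_lt t with hd | hd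
  · have h1 : Tendsto (fun s => t - s) (𝓝[tsIci X t₀] t) (𝓝 0) := by
      have : Tendsto (fun s : ℝ => t - s) (𝓝 t) (𝓝 (t - t)) :=
        tendsto_const_nhds.sub tendsto_id
      rw [sub_self] at this
      exact this.mono_left nhdsWithin_le_nhds
    rw [HasDeltaDerivAt, hd] at hu
    have h2 := hu.trans_tendsto h1
    have h3 : Tendsto (fun s => u t - (u t - u s - (t - s) • d) - (t - s) • d)
        (𝓝[tsIci X t₀] t) (𝓝 (u t - 0 - (0 : ℝ) • d)) :=
      (tendsto_const_nhds.sub h2).sub (h1.smul_const d)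
    rw [ContinuousWithinAt]
    convert h3 using 2
    · abel
    · simp
  · rw [ContinuousWithinAt, h.nhdsWithin_eq_pure ht hd]
    exact tendsto_pure_nhds _ _

/-- A function with a continuous delta derivative is a primitive of it. -/
theorem HasDensity.of_hasDeltaDerivAt [CompleteSpace E] {u u' : ℝ → E} (h : IsSturmian X t₀)
    (hu : ∀ t ∈ tsIci X t₀, HasDeltaDerivAt X t₀ u (u' t) t)
    (hu' : ContinuousOn u' (tsIci X t₀)) : HasDensity X t₀ u u' := by
  set ν := deltaMeasure X t₀ with hν
  have hint : ∀ b, IntegrableOn u' (Set.Ico t₀ b) ν := h.integrableOn_of_continuousOn hu'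
  refine ⟨hint, fun s hs t ht hst => ?_⟩
  have main : ∀ ε > 0, ‖∫ r in Set.Ico s t, u' r ∂ν - (u t - u s)‖ ≤ ε * (t - s) := by
    intro ε hε
    refine h.rel_of_local (R := fun s t => ‖∫ r in Set.Ico s t, u' r ∂ν - (u t - u s)‖
      ≤ ε * (t - s)) (fun t _ => by simp) ?_ ?_ ?_ hs ht hst
    · intro r hr s hs t ht hrs hst h1 h2
      rw [setIntegral_Ico_add hint hr hs hrs hst]
      have e : ε * (t - r) = ε * (s - r) + ε * (t - s) := by ring
      rw [e]
      refine le_trans (le_of_eq ?_) ((norm_add_le _ _).trans (add_le_add h1 h2))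
      congr 1
      abel
    · intro t ht hd
      rw [h.setIntegral_Ico_forwardJump ht, (hu t ht).eq_add ht]
      simpa using mul_nonneg hε.le (sub_nonneg.2 hd.le)
    · intro c hc hd
      have e1 := Asymptotics.IsLittleO.def (hu c hc) (half_pos hε)
      rw [hd] at e1
      filter_upwards [eventually_norm_setIntegral_sub_le h hint (hu' c hc) hc (half_pos hε), e1]
        with s h1 h2
      refine ⟨fun hle => ?_, fun hle => ?_⟩
      · rw [Real.norm_of_nonneg (sub_nonneg.2 hle)] at h2
        have := (norm_sub_le _ _).trans (add_le_add (h1.1 hle) h2)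
        rw [sub_sub_sub_cancel_right] at this
        linarith
      · rw [Real.norm_of_nonpos (sub_nonpos.2 hle)] at h2
        have := (norm_add_le _ _).trans (add_le_add (h1.2 hle) h2)
        have e : ∫ r in Set.Ico c s, u' r ∂ν - (s - c) • u' c + (u c - u s - (c - s) • u' c)
            = ∫ r in Set.Ico c s, u' r ∂ν - (u s - u c) := by
          module
        rw [e] at this
        linarith
  have hlim : ‖∫ r in Set.Ico s t, u' r ∂ν - (u t - u s)‖ ≤ 0 := by
    refine le_of_forall_pos_le_add fun ε hε => ?_
    have h0 := sub_nonneg.2 hst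
    refine (main (ε / (t - s + 1)) (by positivity)).trans ?_
    rw [zero_add, div_mul_eq_mul_div, div_le_iff₀ (by positivity)]
    nlinarith
  exact sub_eq_zero.1 (norm_le_zero_iff.1 hlim)

theorem HasDensity.hasDeltaDerivAt [CompleteSpace E] {u u' : ℝ → E} (h : IsSturmian X t₀)
    (hu : HasDensity X t₀ u u') {t : ℝ} (ht : t ∈ tsIci X t₀)
    (hc : ContinuousWithinAt u' (tsIci X t₀) t) : HasDeltaDerivAt X t₀ u (u' t) t := by
  rcases h.forwardJump_eq_or_lt t with hd | hd
  · refine Asymptotics.IsLittleO.of_bound fun ε hε => ?_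
    rw [hd]
    filter_upwards [eventually_norm_setIntegral_sub_le h hu.1 hc ht hε,
      eventually_mem_nhdsWithin] with s h1 hs
    rcases le_total s t with hle | hle
    · have := h1.1 hle
      rw [hu.2 s hs t ht hle] at this
      rwa [Real.norm_of_nonneg (sub_nonneg.2 hle)]
    · have := h1.2 hle
      rw [hu.2 t ht s hs hle] at this
      rw [Real.norm_of_nonpos (sub_nonpos.2 hle), neg_sub]
      refine le_trans (le_of_eq ?_) this
      rw [← norm_neg]
      congr 1
      module
  · exact hasDeltaDerivAt_of_lt h ht hd (hu.eq_add h ht)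

/-! ### Lebesgue differentiation on the time scale. -/

theorem IsSturmian.monotone_forwardJump (h : IsSturmian X t₀) : Monotone (forwardJump X) := by
  intro s t hst
  rcases hst.eq_or_lt with rfl | hlt
  · exact le_rfl
  · rw [h.forwardJump_eq t]
    exact le_csInf (h.nonempty_Ioi t) fun r hr => h.forwardJump_le hr.1 (hlt.trans hr.2)

/-- The retraction is injective over right-dense points: otherwise a point of X would lie strictly
between its value and x. -/
theorem IsSturmian.sSup_eq_of_dense (h : IsSturmian X t₀) {x : ℝ} (hx : t₀ ≤ x)
    (hd : forwardJump X (sSup (X ∩ Set.Iic x)) = sSup (X ∩ Set.Iic x)) :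
    sSup (X ∩ Set.Iic x) = x := by
  refine (h.sSup_le_self hx).antisymm (not_lt.1 fun hlt => ?_)
  obtain ⟨s, hs, h1, h2⟩ := h.exists_mem_Ioo (h.sSup_mem hx) hd hlt
  exact absurd ((h.le_sSup_iff hx hs.1).2 h2.le) (not_le.2 h1)

theorem IsSturmian.restrict_Ico_eq_map (h : IsSturmian X t₀) {a b : ℝ} (ha : a ∈ tsIci X t₀)
    (hb : b ∈ tsIci X t₀) : (deltaMeasure X t₀).restrict (Set.Ico a b) =
      (volume.restrict (Set.Ico a b)).map fun x => sSup (X ∩ Set.Iic x) := by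
  rw [deltaMeasure, Measure.restrict_map_of_aemeasurable h.aemeasurable_sSup measurableSet_Ico,
    Measure.restrict_restrict' measurableSet_Ici, h.preimage_Ico ha hb]

theorem HasDensity.ae_hasDeltaDerivAt [CompleteSpace E] {u u' : ℝ → E} (h : IsSturmian X t₀)
    (hu : HasDensity X t₀ u u') :
    ∀ᵐ t ∂(deltaMeasure X t₀), HasDeltaDerivAt X t₀ u (u' t) t := by
  set p : ℝ → ℝ := fun x => sSup (X ∩ Set.Iic x) with hp
  have hpm : ∀ b, AEMeasurable p (volume.restrict (Set.Ico t₀ b)) := fun b =>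
    h.aemeasurable_sSup.mono_measure (Measure.restrict_mono_set _ Set.Ico_subset_Ici_self)
  -- Extending u' constantly over gaps, and by zero to the left of t₀, gives a locally integrable
  -- function on the real line whose primitive agrees with u - u(t₀) on the time scale.
  set g : ℝ → E := (Set.Ici t₀).indicator (u' ∘ p) with hg
  have hint : ∀ b ∈ tsIci X t₀, IntegrableOn (u' ∘ p) (Set.Ico t₀ b) volume := fun b hb => by
    have h1 := hu.1 b
    rw [IntegrableOn, h.restrict_Ico_eq_map h.left_mem hb] at h1
    exact (integrable_map_measure h1.1 (hpm b)).1 h1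
  have hloc : LocallyIntegrable g volume := fun x => by
    obtain ⟨b, hb, hxb⟩ := h.exists_ge (x + 1)
    refine ⟨Set.Iio b, Iio_mem_nhds (by linarith), ?_⟩
    rw [IntegrableOn, hg, integrable_indicator_iff measurableSet_Ici, IntegrableOn,
      Measure.restrict_restrict measurableSet_Ici, Set.Ici_inter_Iio]
    exact hint b hb
  have hG : ∀ t ∈ tsIci X t₀, ∫ x in t₀..t, g x = u t - u t₀ := fun t ht => by
    rw [intervalIntegral.integral_of_le ht.2, ← integral_Ico_eq_integral_Ioc,
      ← hu.2 t₀ h.left_mem t ht ht.2, h.restrict_Ico_eq_map h.left_mem ht,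
      integral_map (hpm t) ?_]
    · exact setIntegral_congr_fun measurableSet_Ico fun x hx => by
        simp [hg, Set.indicator_of_mem (Set.mem_Ici.2 hx.1), hp]
    · rw [← h.restrict_Ico_eq_map h.left_mem ht]
      exact (hu.1 t).1
  have hae := LocallyIntegrable.ae_hasDerivAt_integral hloc
  obtain ⟨s, hsub, hsm, hs0⟩ := exists_measurable_superset_of_null (ae_iff.1 hae)
  -- Exceptional points are removed only among right-dense ones: the retraction has fibre {t} there,
  -- so Lebesgue null sets stay null. A right-scattered point is an atom, but differentiability
  -- holds there without exception.
  have hDm : MeasurableSet (s ∩ (tsIci X t₀ ∩ {t | forwardJump X t = t})) :=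
    hsm.inter (h.measurableSet_tsIci.inter
      (measurableSet_eq_fun h.monotone_forwardJump.measurable measurable_id))
  have hD0 : deltaMeasure X t₀ (s ∩ (tsIci X t₀ ∩ {t | forwardJump X t = t})) = 0 := by
    rw [h.deltaMeasure_apply hDm]
    refine measure_mono_null ?_ hs0
    rintro x ⟨⟨h1, _, h3⟩, hx⟩
    exact (h.sSup_eq_of_dense hx h3) ▸ h1
  filter_upwards [h.ae_mem, measure_eq_zero_iff_ae_notMem.1 hD0] with t ht hts
  rcases h.forwardJump_eq_or_lt t with hd | hd
  · have h1 : t ∉ s := fun hmem => hts ⟨hmem, ht, hd⟩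
    have h2 : HasDerivAt (fun x => ∫ y in t₀..x, g y) (g t) t := by
      by_contra hcon
      exact h1 (hsub fun hall => hcon (hall t₀))
    have hpt : p t = t := (h.sSup_le_self ht.2).antisymm ((h.le_sSup_iff ht.2 ht.1).2 le_rfl)
    have h3 : g t = u' t := by
      rw [hg, Set.indicator_of_mem ht.2, Function.comp, hpt]
    rw [h3] at h2
    have h4 := (hasDerivAt_iff_isLittleO.1 h2).mono (nhdsWithin_le_nhds (s := tsIci X t₀))
    rw [HasDeltaDerivAt, hd]
    refine (h4.neg_left.neg_right).congr' ?_ ?_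
    · filter_upwards [eventually_mem_nhdsWithin] with r hr
      rw [hG r hr, hG t ht]
      module
    · exact Eventually.of_forall fun r => by simp
  · exact hasDeltaDerivAt_of_lt h ht hd (hu.eq_add h ht)

end Density

/-! ### Matrix-valued functions with a density -/

/-- Entrywise version of `HasDensity`. -/
def MatHasDensity {m k : Type*} (X : Set ℝ) (t₀ : ℝ) (P P' : ℝ → Matrix m k ℂ) : Prop :=
  ∀ i j, HasDensity X t₀ (fun t => P t i j) (fun t => P' t i j)

namespace MatHasDensity

variable {X : Set ℝ} {t₀ : ℝ} {m k l : Type*}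

theorem congr {P P' Q Q' : ℝ → Matrix m k ℂ} (h : IsSturmian X t₀) (hP : MatHasDensity X t₀ P P')
    (hPQ : ∀ t ∈ tsIci X t₀, P t = Q t) (hPQ' : ∀ t ∈ tsIci X t₀, P' t = Q' t) :
    MatHasDensity X t₀ Q Q' := fun i j =>
  (hP i j).congr h (fun t ht => by rw [hPQ t ht]) (fun t ht => by rw [hPQ' t ht])

theorem const (c : Matrix m k ℂ) : MatHasDensity X t₀ (fun _ => c) (fun _ => 0) :=
  fun i j => HasDensity.const (c i j)

theorem add {P P' Q Q' : ℝ → Matrix m k ℂ} (hP : MatHasDensity X t₀ P P')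
    (hQ : MatHasDensity X t₀ Q Q') :
    MatHasDensity X t₀ (fun t => P t + Q t) (fun t => P' t + Q' t) :=
  fun i j => (hP i j).add (hQ i j)

theorem conjTranspose {P P' : ℝ → Matrix m k ℂ} (hP : MatHasDensity X t₀ P P') :
    MatHasDensity X t₀ (fun t => (P t)ᴴ) (fun t => (P' t)ᴴ) :=
  fun i j => (hP j i).clm_comp (Complex.conjCLE : ℂ →L[ℝ] ℂ)

theorem mul [Fintype k] {P P' : ℝ → Matrix m k ℂ} {Q Q' : ℝ → Matrix k l ℂ}
    (h : IsSturmian X t₀) (hP : MatHasDensity X t₀ P P') (hQ : MatHasDensity X t₀ Q Q') :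
    MatHasDensity X t₀ (fun t => P t * Q t)
      (fun t => P' t * Q (forwardJump X t) + P t * Q' t) := by
  intro i j
  refine (HasDensity.sum fun r : k => (hP i r).mul h (hQ r j)).congr h (fun t _ => ?_)
    (fun t _ => ?_)
  · exact Matrix.mul_apply.symm
  · change _ = (P' t * Q (forwardJump X t)) i j + (P t * Q' t) i j
    rw [Matrix.mul_apply, Matrix.mul_apply, Finset.sum_add_distrib]

theorem mul_const [Fintype k] {P P' : ℝ → Matrix m k ℂ} (h : IsSturmian X t₀)
    (hP : MatHasDensity X t₀ P P') (K : Matrix k l ℂ) :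
    MatHasDensity X t₀ (fun t => P t * K) (fun t => P' t * K) :=
  (hP.mul h (const K)).congr h (fun _ _ => rfl) (fun _ _ => by simp)

theorem const_mul [Fintype k] {P P' : ℝ → Matrix k l ℂ} (h : IsSturmian X t₀)
    (hP : MatHasDensity X t₀ P P') (K : Matrix m k ℂ) :
    MatHasDensity X t₀ (fun t => K * P t) (fun t => K * P' t) :=
  ((const K).mul h hP).congr h (fun _ _ => rfl) (fun _ _ => by simp)

theorem eq_add {P P' : ℝ → Matrix m k ℂ} (h : IsSturmian X t₀) (hP : MatHasDensity X t₀ P P')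
    {t : ℝ} (ht : t ∈ tsIci X t₀) :
    P (forwardJump X t) = P t + (graininess X t : ℂ) • P' t := by
  ext i j
  simpa using (hP i j).eq_add h ht

theorem eq_of_zero {P : ℝ → Matrix m k ℂ} (h : IsSturmian X t₀)
    (hP : MatHasDensity X t₀ P fun _ => 0) {t : ℝ} (ht : t ∈ tsIci X t₀) : P t = P t₀ := by
  ext i j
  have := (hP i j).2 t₀ h.left_mem t ht ht.2
  simpa [sub_eq_zero, eq_comm] using this

end MatHasDensity

/-! ### Block matrix identities -/

section Algebra

variable {n : ℕ}

/-- The projection onto the last `n` coordinates. -/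
def lowerProj (n : ℕ) : Matrix (Fin n ⊕ Fin n) (Fin n ⊕ Fin n) ℂ := fromBlocks 0 0 0 1

local notation "𝐉" => Matrix.J (Fin n) ℂ
local notation "𝐏" => lowerProj n

theorem lowerProj_conjTranspose : (𝐏)ᴴ = 𝐏 := by
  simp [lowerProj, fromBlocks_conjTranspose]

theorem J_conjTranspose : (𝐉)ᴴ = -𝐉 := by
  simp [Matrix.J, fromBlocks_conjTranspose, fromBlocks_neg]

/-- The condition P K + K P = K says that K has zero diagonal blocks; this is the only property of J
and of 𝒰₂ₙJ that the product rule for shifted functions needs. -/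
theorem lowerProj_J : 𝐏 * 𝐉 + 𝐉 * 𝐏 = 𝐉 := by
  simp [lowerProj, Matrix.J, fromBlocks_multiply, fromBlocks_add]

theorem J_mul_J_mul {k : Type*} (P : Matrix (Fin n ⊕ Fin n) k ℂ) : 𝐉 * (𝐉 * P) = -P := by
  rw [← Matrix.mul_assoc, Matrix.J_squared, Matrix.neg_mul, Matrix.one_mul]

theorem bigU_J (U : Matrix (Fin n) (Fin n) ℂ) : bigU U * 𝐉 = fromBlocks 0 (-U) (-Uᴴ) 0 := by
  simp [bigU, Matrix.J, fromBlocks_multiply]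

theorem bigU_J_conjTranspose (U : Matrix (Fin n) (Fin n) ℂ) : (bigU U * 𝐉)ᴴ = bigU U * 𝐉 := by
  simp [bigU_J, fromBlocks_conjTranspose]

theorem lowerProj_bigU_J (U : Matrix (Fin n) (Fin n) ℂ) :
    𝐏 * (bigU U * 𝐉) + bigU U * 𝐉 * 𝐏 = bigU U * 𝐉 := by
  simp [bigU_J, lowerProj, fromBlocks_multiply, fromBlocks_add]

/-- With Z' = -J C* Z the adjoint equation and P J + J P = J give Z*(J - μ C P) = (Ẑ + μ Z')* J,
that is, Ẑ* J at σ(t). The Lagrange identity at σ(t) then says that Z*(J - μ C P) W = J, where W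
plays the role of Ŷ(σ(t)). -/
theorem shifted_solution_mul {C Y Z Yh Zh : Matrix (Fin n ⊕ Fin n) (Fin n ⊕ Fin n) ℂ} {μ : ℝ}
    (hZ : Z = Zh + (μ : ℂ) • (𝐏 * (-(𝐉 * (Cᴴ * Z)))))
    (hW : (Zh + (μ : ℂ) • (-(𝐉 * (Cᴴ * Z))))ᴴ * 𝐉 * (Yh + (μ : ℂ) • (-(𝐉 * (C * Y)))) = 𝐉) :
    (𝐉 - (μ : ℂ) • (C * 𝐏)) * ((Yh + (μ : ℂ) • (-(𝐉 * (C * Y)))) * (-(𝐉 * Zᴴ))) = 1 := by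
  set W := Yh + (μ : ℂ) • (-(𝐉 * (C * Y)))
  set Z' := -(𝐉 * (Cᴴ * Z)) with hZ'
  have h1 : Zᴴ * C = -(Z'ᴴ * 𝐉) := by
    rw [hZ', conjTranspose_neg, conjTranspose_mul, conjTranspose_mul, J_conjTranspose,
      conjTranspose_conjTranspose, Matrix.mul_neg, neg_neg, Matrix.mul_assoc _ 𝐉 𝐉,
      Matrix.J_squared]
    simp
  have h2 : Zᴴ = Zhᴴ + (μ : ℂ) • (Z'ᴴ * 𝐏) := by
    conv_lhs => rw [hZ]
    simp [conjTranspose_add, conjTranspose_smul, conjTranspose_mul, lowerProj_conjTranspose]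
  have h3 : Zᴴ * ((𝐉 - (μ : ℂ) • (C * 𝐏)) * W) = 𝐉 := by
    have e : Zᴴ * (𝐉 - (μ : ℂ) • (C * 𝐏)) = (Zh + (μ : ℂ) • Z')ᴴ * 𝐉 := by
      rw [Matrix.mul_sub, Matrix.mul_smul, ← Matrix.mul_assoc, h1, h2]
      conv_rhs => rw [conjTranspose_add, Matrix.add_mul, conjTranspose_smul, Matrix.smul_mul]
      conv_rhs => enter [2, 2]; rw [← lowerProj_J]
      simp only [Matrix.add_mul, Matrix.mul_add, Matrix.smul_mul, Matrix.neg_mul,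
        Matrix.mul_assoc, smul_neg, sub_neg_eq_add, smul_add, Complex.star_def,
        Complex.conj_ofReal, add_assoc]
    rw [← Matrix.mul_assoc, e, hW]
  -- For square matrices the order of the factors may be exchanged, which brings -J Z* to the left,
  -- where the previous identity applies.
  rw [← Matrix.mul_assoc, mul_eq_one_comm, Matrix.neg_mul, Matrix.mul_assoc, h3, Matrix.J_squared,
    neg_neg]

/-- J - μ C P has upper block row (0, -(I + μ C₂)), so the upper row of the inverse equation alone
determines the lower row of V. This produces the matrix N of the Green function. -/
theorem smul_lowerProj_mul {C₁ C₂ C₃ C₄ : Matrix (Fin n) (Fin n) ℂ}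
    {V : Matrix (Fin n ⊕ Fin n) (Fin n ⊕ Fin n) ℂ} {μ : ℂ} (hC : IsUnit (1 + μ • C₂))
    (hV : (𝐉 - μ • (fromBlocks C₁ C₂ C₃ C₄ * 𝐏)) * V = 1) :
    μ • (𝐏 * V) = fromBlocks 0 0 (-(μ • (1 + μ • C₂)⁻¹)) 0 := by
  obtain ⟨V₁, V₂, V₃, V₄, rfl⟩ : ∃ V₁ V₂ V₃ V₄, V = fromBlocks V₁ V₂ V₃ V₄ :=
    ⟨_, _, _, _, (fromBlocks_toBlocks V).symm⟩
  have hJ : 𝐉 - μ • (fromBlocks C₁ C₂ C₃ C₄ * 𝐏) =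
      fromBlocks 0 (-(1 + μ • C₂)) 1 (-(μ • C₄)) := by
    simp [Matrix.J, lowerProj, fromBlocks_multiply, fromBlocks_smul, sub_eq_add_neg,
      fromBlocks_neg, fromBlocks_add, add_comm]
  rw [hJ, fromBlocks_multiply, ← fromBlocks_one, fromBlocks_inj] at hV
  obtain ⟨h1, h2, -, -⟩ := hV
  have hdet := (Matrix.isUnit_iff_isUnit_det _).1 hC
  have e3 : V₃ = -(1 + μ • C₂)⁻¹ := by
    rw [Matrix.zero_mul, zero_add, Matrix.neg_mul, neg_eq_iff_eq_neg] at h1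
    rw [← Matrix.nonsing_inv_mul_cancel_left _ V₃ hdet, h1]
    simp
  have e4 : V₄ = 0 := by
    rw [Matrix.zero_mul, zero_add, Matrix.neg_mul, neg_eq_zero] at h2
    rw [← Matrix.nonsing_inv_mul_cancel_left _ V₄ hdet, h2]
    simp
  simp [lowerProj, fromBlocks_multiply, fromBlocks_smul, e3, e4]

theorem conjTranspose_mul_mul_apply {m k ι κ : Type*} [Fintype m] [Fintype k] (y : Matrix m ι ℂ)
    (K : Matrix m k ℂ) (x : Matrix k κ ℂ) (i : ι) (j : κ) :
    (yᴴ * (K * x)) i j = star (y.col i) ⬝ᵥ (K *ᵥ x.col j) := rfl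

end Algebra

/-! ### Lagrange identity, variation of constants and energy identity. -/

section Forms

variable {X : Set ℝ} {t₀ : ℝ} {n : ℕ}

local notation "𝐉" => Matrix.J (Fin n) ℂ
local notation "𝐏" => lowerProj n

/-- Derivative of a sesquilinear form of two partially shifted functions. -/
theorem MatHasDensity.form {ι κ : Type*} (h : IsSturmian X t₀)
    {z z' : ℝ → Matrix (Fin n ⊕ Fin n) ι ℂ} {u u' : ℝ → Matrix (Fin n ⊕ Fin n) κ ℂ}
    (hz : MatHasDensity X t₀ z z') (hu : MatHasDensity X t₀ u u')
    {K : Matrix (Fin n ⊕ Fin n) (Fin n ⊕ Fin n) ℂ} (hK : 𝐏 * K + K * 𝐏 = K) :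
    MatHasDensity X t₀ (fun t => (z t)ᴴ * (K * u t)) (fun t =>
      (z' t)ᴴ * (K * (u t + (graininess X t : ℂ) • (𝐏 * u' t))) +
      (z t + (graininess X t : ℂ) • (𝐏 * z' t))ᴴ * (K * u' t)) := by
  refine (hz.conjTranspose.mul h (hu.const_mul h K)).congr h (fun _ _ => rfl) fun t ht => ?_
  rw [hu.eq_add h ht]
  -- The product rule gives z'* K (u + μ u') + z* K u'. Splitting K u' keeps μ z'* K P u' in the
  -- first summand and moves μ z'* P K u' to the second, where it completes z + μ P z'.
  have e : K * u' t = 𝐏 * (K * u' t) + K * (𝐏 * u' t) := by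
    rw [← Matrix.mul_assoc, ← Matrix.mul_assoc, ← Matrix.add_mul, hK]
  conv_lhs => rw [Matrix.mul_add K, Matrix.mul_smul K, Matrix.mul_add, Matrix.mul_smul]
  conv_lhs => enter [1, 2, 2]; rw [e]
  simp only [conjTranspose_add, conjTranspose_smul, conjTranspose_mul, lowerProj_conjTranspose,
    Matrix.add_mul, Matrix.mul_add, Matrix.smul_mul, Matrix.mul_smul, Matrix.mul_assoc, smul_add,
    Complex.star_def, Complex.conj_ofReal]
  abel

/-- By the product rule for forms with K = J the derivative is Z'* J Y + Z* J Y', now in the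
unshifted functions; the adjoint equation makes the two terms -Z* C Y and Z* C Y. -/
theorem matHasDensity_lagrange {ι κ : Type*} (h : IsSturmian X t₀)
    {C : ℝ → Matrix (Fin n ⊕ Fin n) (Fin n ⊕ Fin n) ℂ}
    {Zh Z : ℝ → Matrix (Fin n ⊕ Fin n) ι ℂ} {Yh Y : ℝ → Matrix (Fin n ⊕ Fin n) κ ℂ}
    (hZ : MatHasDensity X t₀ Zh fun t => -(𝐉 * ((C t)ᴴ * Z t)))
    (hY : MatHasDensity X t₀ Yh fun t => -(𝐉 * (C t * Y t)))
    (hZ' : ∀ t ∈ tsIci X t₀,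
      Z t = Zh t + (graininess X t : ℂ) • (𝐏 * (-(𝐉 * ((C t)ᴴ * Z t)))))
    (hY' : ∀ t ∈ tsIci X t₀, Y t = Yh t + (graininess X t : ℂ) • (𝐏 * (-(𝐉 * (C t * Y t))))) :
    MatHasDensity X t₀ (fun t => (Zh t)ᴴ * (𝐉 * Yh t)) fun _ => 0 := by
  refine (hZ.form h hY lowerProj_J).congr h (fun _ _ => rfl) fun t ht => ?_
  rw [← hZ' t ht, ← hY' t ht, Matrix.mul_neg 𝐉, J_mul_J_mul, neg_neg, conjTranspose_neg,
    conjTranspose_mul, J_conjTranspose, Matrix.mul_neg, neg_neg, Matrix.mul_assoc, J_mul_J_mul,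
    conjTranspose_mul, conjTranspose_conjTranspose, Matrix.mul_neg, Matrix.mul_assoc,
    neg_add_cancel]

/-- Variation of constants: `y = u + μ P u'` solves `J u' = C y + G`. -/
theorem MatHasDensity.variation {ι : Type*} (h : IsSturmian X t₀)
    {C Yh Y Zh Z : ℝ → Matrix (Fin n ⊕ Fin n) (Fin n ⊕ Fin n) ℂ}
    {G k : ℝ → Matrix (Fin n ⊕ Fin n) ι ℂ}
    (hZ : MatHasDensity X t₀ Zh fun t => -(𝐉 * ((C t)ᴴ * Z t)))
    (hY : MatHasDensity X t₀ Yh fun t => -(𝐉 * (C t * Y t)))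
    (hZ' : ∀ t ∈ tsIci X t₀,
      Z t = Zh t + (graininess X t : ℂ) • (𝐏 * (-(𝐉 * ((C t)ᴴ * Z t)))))
    (hY' : ∀ t ∈ tsIci X t₀, Y t = Yh t + (graininess X t : ℂ) • (𝐏 * (-(𝐉 * (C t * Y t)))))
    (hinit : (Zh t₀)ᴴ * (𝐉 * Yh t₀) = 𝐉)
    (hk : MatHasDensity X t₀ k fun t => -(𝐉 * ((Z t)ᴴ * G t))) :
    ∃ u' V : ℝ → _, MatHasDensity X t₀ (fun t => Yh t * k t) u' ∧ ∀ t ∈ tsIci X t₀,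
      (𝐉 - (graininess X t : ℂ) • (C t * 𝐏)) * V t = 1 ∧
      Yh t * k t + (graininess X t : ℂ) • (𝐏 * u' t) =
        Y t * k t + (graininess X t : ℂ) • (𝐏 * V t) * G t ∧
      𝐉 * u' t = C t * (Yh t * k t + (graininess X t : ℂ) • (𝐏 * u' t)) + G t := by
  -- V is Ŷ(σ(t)) times -J Z(t)*, the explicit inverse of J - μ C P.
  refine ⟨_, fun t => (Yh t + (graininess X t : ℂ) • (-(𝐉 * (C t * Y t)))) * (-(𝐉 * (Z t)ᴴ)),
    hY.mul h hk, fun t ht => ?_⟩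
  have hW : (Zh t + (graininess X t : ℂ) • (-(𝐉 * ((C t)ᴴ * Z t))))ᴴ * 𝐉 *
      (Yh t + (graininess X t : ℂ) • (-(𝐉 * (C t * Y t)))) = 𝐉 := by
    have h1 := (matHasDensity_lagrange h hZ hY hZ' hY').eq_of_zero h (h.forwardJump_mem ht)
    rwa [hZ.eq_add h ht, hY.eq_add h ht, hinit, ← Matrix.mul_assoc] at h1
  have hV := shifted_solution_mul (hZ' t ht) hW
  have hYt := hY' t ht
  rw [hk.eq_add h ht]
  set μ : ℂ := (graininess X t : ℂ)
  set Y' := -(𝐉 * (C t * Y t)) with hY'def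
  set W := Yh t + μ • Y' with hWdef
  have hk' : -(𝐉 * ((Z t)ᴴ * G t)) = -(𝐉 * (Z t)ᴴ) * G t := by
    rw [Matrix.neg_mul, Matrix.mul_assoc]
  set k' := -(𝐉 * ((Z t)ᴴ * G t))
  have e1 : Y' * (k t + μ • k') + Yh t * k' = Y' * k t + W * k' := by
    rw [hWdef, Matrix.mul_add, Matrix.add_mul, Matrix.mul_smul, Matrix.smul_mul]
    abel
  have e2 : Yh t * k t + μ • (𝐏 * (Y' * k t + W * k')) = Y t * k t + μ • (𝐏 * (W * k')) := by
    conv_rhs => rw [hYt]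
    rw [Matrix.mul_add 𝐏, Matrix.add_mul (Yh t) (μ • (𝐏 * Y')), Matrix.smul_mul, Matrix.mul_assoc,
      smul_add, add_assoc]
  rw [e1, e2]
  refine ⟨hV, ?_, ?_⟩
  · rw [hk', ← Matrix.mul_assoc W, ← Matrix.mul_assoc 𝐏, Matrix.smul_mul]
  · have e3 : (𝐉 - μ • (C t * 𝐏)) * (W * k') = G t := by
      rw [hk', ← Matrix.mul_assoc W, ← Matrix.mul_assoc, hV, Matrix.one_mul]
    rw [Matrix.sub_mul, sub_eq_iff_eq_add] at e3
    rw [Matrix.mul_add, e3, hY'def, Matrix.neg_mul, Matrix.mul_neg, Matrix.mul_assoc, J_mul_J_mul,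
      neg_neg, Matrix.mul_add]
    simp only [Matrix.mul_assoc, Matrix.smul_mul, Matrix.mul_smul]
    abel

/-- Derivative of the indefinite form `u* 𝒰₂ₙ J u` along solutions of `J u' = C y + G`. -/
theorem MatHasDensity.energy {ι : Type*} (h : IsSturmian X t₀) (U : Matrix (Fin n) (Fin n) ℂ)
    {C : ℝ → Matrix (Fin n ⊕ Fin n) (Fin n ⊕ Fin n) ℂ}
    {u u' y G : ℝ → Matrix (Fin n ⊕ Fin n) ι ℂ}
    (hu : MatHasDensity X t₀ u u')
    (hy : ∀ t ∈ tsIci X t₀, y t = u t + (graininess X t : ℂ) • (𝐏 * u' t))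
    (hsol : ∀ t ∈ tsIci X t₀, 𝐉 * u' t = C t * y t + G t) (j : ι) :
    HasDensity X t₀ (fun t => ((u t)ᴴ * (bigU U * 𝐉 * u t)).diag j |>.re)
      (fun t => 2 * (star ((y t).col j) ⬝ᵥ (bigU U *ᵥ (C t *ᵥ (y t).col j + (G t).col j))).re) := by
  have h1 := ((hu.form h hu (lowerProj_bigU_J U)) j j).clm_comp Complex.reCLM
  refine h1.congr h (fun _ _ => rfl) fun t ht => ?_
  dsimp only
  rw [← hy t ht]
  have e1 : (y t)ᴴ * (bigU U * 𝐉 * u' t) = (y t)ᴴ * (bigU U * (C t * y t + G t)) := by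
    rw [← hsol t ht, Matrix.mul_assoc (bigU U)]
  -- Since 𝒰J is Hermitian, the two terms of the product rule are adjoint to each other; their
  -- diagonal entries add up to twice a real part.
  have e2 : (u' t)ᴴ * (bigU U * 𝐉 * y t) = ((y t)ᴴ * (bigU U * (C t * y t + G t)))ᴴ := by
    rw [← e1, conjTranspose_mul, conjTranspose_conjTranspose, conjTranspose_mul,
      bigU_J_conjTranspose, Matrix.mul_assoc (u' t)ᴴ]
  rw [e1, e2, Matrix.add_apply, conjTranspose_apply, conjTranspose_mul_mul_apply]
  have e3 : (C t * y t + G t).col j = C t *ᵥ (y t).col j + (G t).col j := rfl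
  rw [e3, map_add]
  simp only [Complex.reCLM_apply, Complex.star_def, Complex.conj_re]
  ring

end Forms

/-! ### Hermitian forms -/

section HermitianForms

variable {m : Type*} [Fintype m]

theorem star_dotProduct_mulVec_comm (K : Matrix m m ℂ) (a b : m → ℂ) :
    star b ⬝ᵥ (Kᴴ *ᵥ a) = star (star a ⬝ᵥ (K *ᵥ b)) := by
  rw [← star_dotProduct, star_mulVec, ← dotProduct_mulVec]

theorem re_form_smul_add {K : Matrix m m ℂ} (hK : K.IsHermitian) (c : ℂ) (a b : m → ℂ) :
    (star (c • a + b) ⬝ᵥ (K *ᵥ (c • a + b))).re =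
      ‖c‖ ^ 2 * (star a ⬝ᵥ (K *ᵥ a)).re + 2 * (star c * (star a ⬝ᵥ (K *ᵥ b))).re +
        (star b ⬝ᵥ (K *ᵥ b)).re := by
  have h1 : star b ⬝ᵥ (K *ᵥ a) = star (star a ⬝ᵥ (K *ᵥ b)) := by
    conv_lhs => rw [← hK.eq]
    exact star_dotProduct_mulVec_comm K a b
  simp only [star_add, star_smul, mulVec_add, mulVec_smul, add_dotProduct, dotProduct_add,
    smul_dotProduct, dotProduct_smul, smul_eq_mul, h1]
  have h2 : c * (star c * (star a ⬝ᵥ (K *ᵥ a))) = ((‖c‖ ^ 2 : ℝ) : ℂ) * (star a ⬝ᵥ (K *ᵥ a)) := by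
    rw [← mul_assoc, Complex.star_def, Complex.mul_conj']
    push_cast
    rfl
  have h3 : c * star (star a ⬝ᵥ (K *ᵥ b)) = star (star c * (star a ⬝ᵥ (K *ᵥ b))) := by
    rw [star_mul', star_star]
  rw [mul_add, h2, h3]
  simp only [Complex.add_re, Complex.re_ofReal_mul, Complex.star_def, Complex.conj_re]
  ring

theorem re_matRe_form (K : Matrix m m ℂ) (v : m → ℂ) :
    (star v ⬝ᵥ (matRe K *ᵥ v)).re = (star v ⬝ᵥ (K *ᵥ v)).re := by
  rw [matRe, smul_mulVec, add_mulVec, dotProduct_smul, dotProduct_add,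
    star_dotProduct_mulVec_comm, smul_eq_mul, Complex.star_def, Complex.add_conj]
  simp

namespace Matrix.PosSemidef

theorem re_form_nonneg {K : Matrix m m ℂ} (hK : K.PosSemidef) (v : m → ℂ) :
    0 ≤ (star v ⬝ᵥ (K *ᵥ v)).re :=
  (Complex.nonneg_iff.1 (hK.dotProduct_mulVec_nonneg v)).1

theorem form_eq_re {K : Matrix m m ℂ} (hK : K.PosSemidef) (v : m → ℂ) :
    star v ⬝ᵥ (K *ᵥ v) = ((star v ⬝ᵥ (K *ᵥ v)).re : ℂ) :=
  Complex.ext rfl (by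
    simpa using (Complex.nonneg_iff.1 (hK.dotProduct_mulVec_nonneg v)).2.symm)

/-- Young's inequality: expand the nonnegative form at δa + b and divide by δ. -/
theorem neg_le_two_re_form {K : Matrix m m ℂ} (hK : K.PosSemidef) {δ : ℝ} (hδ : 0 < δ)
    (a b : m → ℂ) : -(δ * (star a ⬝ᵥ (K *ᵥ a)).re + δ⁻¹ * (star b ⬝ᵥ (K *ᵥ b)).re) ≤
      2 * (star a ⬝ᵥ (K *ᵥ b)).re := by
  have h := hK.re_form_nonneg ((δ : ℂ) • a + b)
  rw [re_form_smul_add hK.isHermitian, Complex.star_def, Complex.conj_ofReal,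
    Complex.re_ofReal_mul, Complex.norm_real, Real.norm_of_nonneg hδ.le] at h
  have h2 := mul_nonneg (inv_nonneg.2 hδ.le) h
  have h3 : δ⁻¹ * δ = 1 := inv_mul_cancel₀ hδ.ne'
  have e : δ⁻¹ * (δ ^ 2 * (star a ⬝ᵥ (K *ᵥ a)).re + 2 * (δ * (star a ⬝ᵥ (K *ᵥ b)).re) +
      (star b ⬝ᵥ (K *ᵥ b)).re) = (δ⁻¹ * δ) * (δ * (star a ⬝ᵥ (K *ᵥ a)).re) +
      (δ⁻¹ * δ) * (2 * (star a ⬝ᵥ (K *ᵥ b)).re) + δ⁻¹ * (star b ⬝ᵥ (K *ᵥ b)).re := by ring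
  rw [e, h3] at h2
  linarith

theorem two_norm_form_le {K : Matrix m m ℂ} (hK : K.PosSemidef) (a b : m → ℂ) :
    2 * ‖star a ⬝ᵥ (K *ᵥ b)‖ ≤ (star a ⬝ᵥ (K *ᵥ a)).re + (star b ⬝ᵥ (K *ᵥ b)).re := by
  set w := star a ⬝ᵥ (K *ᵥ b) with hw
  rcases eq_or_ne w 0 with h0 | h0
  · rw [h0]
    simpa using add_nonneg (hK.re_form_nonneg a) (hK.re_form_nonneg b)
  have hn : (‖w‖ : ℂ) ≠ 0 := by simpa using h0
  -- The unimodular factor rotates the cross term to -‖w‖.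
  have h := hK.re_form_nonneg ((-w / ‖w‖) • a + b)
  have e : star (-w / (‖w‖ : ℂ)) * w = ((-‖w‖ : ℝ) : ℂ) := by
    rw [Complex.star_def, map_div₀, map_neg, Complex.conj_ofReal, div_mul_eq_mul_div, neg_mul,
      Complex.conj_mul']
    push_cast
    field_simp
  rw [re_form_smul_add hK.isHermitian, ← hw, e, Complex.ofReal_re, norm_div, norm_neg,
    Complex.norm_real, norm_norm, div_self (norm_ne_zero_iff.2 h0)] at h
  linarith

end Matrix.PosSemidef

end HermitianForms

/-! ### Duality of nonpositive subspaces for the indefinite forms 𝒰J and 𝒰⁻¹J. -/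

section Krein

variable {n : ℕ}

local notation "𝐉" => Matrix.J (Fin n) ℂ

theorem bigU_inv {U : Matrix (Fin n) (Fin n) ℂ} (hU : IsUnit U) : (bigU U)⁻¹ = bigU U⁻¹ := by
  have h := (Matrix.isUnit_iff_isUnit_det _).1 hU
  refine inv_eq_left_inv ?_
  have h2 : (U⁻¹)ᴴ * Uᴴ = 1 := by
    rw [← conjTranspose_mul, Matrix.mul_nonsing_inv _ h, conjTranspose_one]
  simp [bigU, fromBlocks_multiply, Matrix.nonsing_inv_mul _ h, h2]

theorem bigU_mul_inv {U : Matrix (Fin n) (Fin n) ℂ} (hU : IsUnit U) :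
    bigU U * bigU U⁻¹ = 1 := by
  have h := (Matrix.isUnit_iff_isUnit_det _).1 hU
  have h2 : Uᴴ * (U⁻¹)ᴴ = 1 := by
    rw [← conjTranspose_mul, Matrix.nonsing_inv_mul _ h, conjTranspose_one]
  simp [bigU, fromBlocks_multiply, Matrix.mul_nonsing_inv _ h, h2]

theorem bigU_inv_conjTranspose_mul {U : Matrix (Fin n) (Fin n) ℂ} (hU : IsUnit U) :
    (bigU U⁻¹)ᴴ * (bigU U)ᴴ = 1 := by
  rw [← conjTranspose_mul, bigU_mul_inv hU, conjTranspose_one]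

/-- The graph v₂ = -U⁻¹ v₁ is an n-dimensional subspace on which the form is positive definite; it
limits the dimension of nonpositive subspaces to n. -/
theorem re_form_bigU_J {U : Matrix (Fin n) (Fin n) ℂ} (hU : IsUnit U) {v : Fin n ⊕ Fin n → ℂ}
    (hv : (fun i => v (Sum.inr i)) = -(U⁻¹ *ᵥ fun i => v (Sum.inl i))) :
    star v ⬝ᵥ ((bigU U * 𝐉) *ᵥ v) =
      2 * (star (fun i => v (Sum.inl i)) ⬝ᵥ fun i => v (Sum.inl i)) := by
  have h := (Matrix.isUnit_iff_isUnit_det _).1 hU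
  obtain ⟨x, y, rfl⟩ : ∃ x y, v = Sum.elim x y := ⟨_, _, (Sum.elim_comp_inl_inr v).symm⟩
  simp only [Sum.elim_inl, Sum.elim_inr] at hv ⊢
  have hv' : y = -(U⁻¹ *ᵥ x) := hv
  have h1 : U *ᵥ y = -x := by
    rw [hv', mulVec_neg, mulVec_mulVec, Matrix.mul_nonsing_inv _ h, one_mulVec]
  have h2 : star y ⬝ᵥ (Uᴴ *ᵥ x) = -(star x ⬝ᵥ x) := by
    rw [star_dotProduct_mulVec_comm, h1, dotProduct_neg, star_neg, ← star_dotProduct]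
  rw [bigU_J, fromBlocks_mulVec]
  have e : star (Sum.elim x y) = Sum.elim (star x) (star y) := by
    ext (i | i) <;> rfl
  rw [e, sumElim_dotProduct_sumElim]
  simp only [Sum.elim_comp_inl, Sum.elim_comp_inr, zero_mulVec, zero_add, add_zero, neg_mulVec,
    dotProduct_neg, h1, h2]
  ring

/-- The `J`-complement of a maximal nonpositive subspace is nonpositive for the dual form. -/
theorem re_form_nonpos_of_nonpos {U : Matrix (Fin n) (Fin n) ℂ} (hU : IsUnit U)
    {Ψ Θ : Matrix (Fin n ⊕ Fin n) (Fin n) ℂ} (hinj : ∀ a, Ψ *ᵥ a = 0 → a = 0)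
    (horth : Θᴴ * (𝐉 * Ψ) = 0) (hΨ : (-(Ψᴴ * (bigU U * 𝐉) * Ψ)).PosSemidef) (c : Fin n → ℂ) :
    (star (Θ *ᵥ c) ⬝ᵥ ((bigU U⁻¹ * 𝐉) *ᵥ (Θ *ᵥ c))).re ≤ 0 := by
  -- This vector is 𝒰J-orthogonal to the range of Ψ, and its 𝒰J-form is minus the 𝒰⁻¹J-form of Θc.
  -- If the claim failed, w would be strictly negative and would enlarge the nonpositive range of Ψ.
  set w := (bigU U⁻¹)ᴴ *ᵥ (Θ *ᵥ c) with hw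
  have hK : (bigU U * 𝐉).IsHermitian := bigU_J_conjTranspose U
  have hw1 : star w ᵥ* bigU U = star (Θ *ᵥ c) := by
    rw [hw, star_mulVec, conjTranspose_conjTranspose, vecMul_vecMul,
      mul_eq_one_comm.1 (bigU_mul_inv hU), vecMul_one]
  have hw2 : ∀ a, star w ⬝ᵥ ((bigU U * 𝐉) *ᵥ (Ψ *ᵥ a)) = 0 := fun a => by
    rw [← mulVec_mulVec, dotProduct_mulVec, hw1, star_mulVec, ← dotProduct_mulVec, mulVec_mulVec,
      mulVec_mulVec, Matrix.mul_assoc, horth, zero_mulVec, dotProduct_zero]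
  have hw3 : star w ⬝ᵥ ((bigU U * 𝐉) *ᵥ w) =
      -(star (Θ *ᵥ c) ⬝ᵥ ((bigU U⁻¹ * 𝐉) *ᵥ (Θ *ᵥ c))) := by
    rw [← mulVec_mulVec, dotProduct_mulVec, hw1, hw, mulVec_mulVec, ← dotProduct_neg, ← neg_mulVec]
    congr 2
    simp [bigU, Matrix.J, fromBlocks_conjTranspose, fromBlocks_multiply, fromBlocks_neg]
  by_contra hcon
  rw [not_le] at hcon
  have hneg : (star w ⬝ᵥ ((bigU U * 𝐉) *ᵥ w)).re < 0 := by
    rw [hw3, Complex.neg_re]; linarith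
  let V : (Fin n → ℂ) × ℂ →ₗ[ℂ] (Fin n ⊕ Fin n → ℂ) :=
    (Matrix.mulVecLin Ψ).coprod (LinearMap.toSpanSingleton ℂ _ w)
  let L : (Fin n ⊕ Fin n → ℂ) →ₗ[ℂ] (Fin n → ℂ) :=
    LinearMap.funLeft ℂ ℂ Sum.inr + (Matrix.mulVecLin U⁻¹) ∘ₗ LinearMap.funLeft ℂ ℂ Sum.inl
  -- There are n + 1 parameters (a, s) and n conditions for s w + Ψ a to lie in the positive graph.
  -- The form of that vector is both nonpositive and 2|v₁|², which forces s = 0, then the vector to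
  -- vanish, and then a = 0 by injectivity.
  have hker : LinearMap.ker (L ∘ₗ V) ≠ ⊥ := LinearMap.ker_ne_bot_of_finrank_lt (by simp)
  obtain ⟨⟨a, s⟩, has, hne⟩ := (Submodule.ne_bot_iff _).1 hker
  set v := s • w + Ψ *ᵥ a with hv
  have hVv : V (a, s) = v := by
    simp [V, hv, add_comm]
  have hL : (fun i => v (Sum.inr i)) = -(U⁻¹ *ᵥ fun i => v (Sum.inl i)) := by
    rw [LinearMap.mem_ker, LinearMap.comp_apply, hVv] at has
    exact eq_neg_of_add_eq_zero_left has
  have hq := congrArg Complex.re (re_form_bigU_J hU hL)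
  have hΨa : (star (Ψ *ᵥ a) ⬝ᵥ ((bigU U * 𝐉) *ᵥ (Ψ *ᵥ a))).re ≤ 0 := by
    have h1 := hΨ.re_form_nonneg a
    rw [neg_mulVec, dotProduct_neg, Complex.neg_re] at h1
    rw [star_mulVec, ← dotProduct_mulVec, mulVec_mulVec, mulVec_mulVec]
    linarith
  rw [hv, re_form_smul_add hK, hw2, mul_zero, Complex.zero_re, mul_zero, add_zero, ← hv] at hq
  set x : Fin n → ℂ := fun i => v (Sum.inl i)
  have hx0 : 0 ≤ star x ⬝ᵥ x := dotProduct_star_self_nonneg x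
  have hxre := (Complex.nonneg_iff.1 hx0).1
  have hre2 : (2 * (star x ⬝ᵥ x)).re = 2 * (star x ⬝ᵥ x).re := by simp
  rw [hre2] at hq
  have hs0 : s = 0 := by
    by_contra hs
    have : 0 < ‖s‖ ^ 2 := by positivity
    nlinarith
  have hx : x = 0 := by
    refine dotProduct_star_self_eq_zero.1 (Complex.ext ?_ (Complex.nonneg_iff.1 hx0).2.symm)
    rw [hs0] at hq
    simp only [norm_zero] at hq
    rw [Complex.zero_re]
    linarith
  have hv0 : v = 0 := by
    rw [hx, mulVec_zero, neg_zero] at hL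
    ext (i | i)
    · exact congrFun hx i
    · exact congrFun hL i
  have ha : a = 0 := hinj a (by rw [hv, hs0] at hv0; simpa using hv0)
  exact hne (by rw [ha, hs0]; rfl)

end Krein

/-! ### Hamiltonian systems -/

/-- The matrix `(I; M)`. -/
def weylRows {n : ℕ} (M : Matrix (Fin n) (Fin n) ℂ) : Matrix (Fin n ⊕ Fin n) (Fin n) ℂ :=
  fromRows 1 M

/-- The matrix `(0; I)`. -/
def lowerRows (n : ℕ) : Matrix (Fin n ⊕ Fin n) (Fin n) ℂ := fromRows 0 1

section Rows

variable {n : ℕ}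

local notation "𝐉" => Matrix.J (Fin n) ℂ

theorem weylSolution_eq (Y : ℝ → Matrix (Fin n ⊕ Fin n) (Fin n ⊕ Fin n) ℂ)
    (M : Matrix (Fin n) (Fin n) ℂ) (t : ℝ) : weylSolution Y M t = Y t * weylRows M := by
  conv_rhs => rw [← fromCols_toCols (Y t), weylRows, fromCols_mul_fromRows, Matrix.mul_one]
  rfl

theorem toCols₂_eq (Y : Matrix (Fin n ⊕ Fin n) (Fin n ⊕ Fin n) ℂ) :
    Y.toCols₂ = Y * lowerRows n := by
  conv_rhs => rw [← fromCols_toCols Y, lowerRows, fromCols_mul_fromRows]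
  simp

theorem weylRows_J (M : Matrix (Fin n) (Fin n) ℂ) : (weylRows Mᴴ)ᴴ * (𝐉 * weylRows M) = 0 := by
  simp [weylRows, Matrix.J, fromBlocks_mul_fromRows,
    conjTranspose_fromRows_eq_fromCols_conjTranspose, fromCols_mul_fromRows]

theorem weylRows_J_lowerRows (M : Matrix (Fin n) (Fin n) ℂ) :
    (weylRows M)ᴴ * (𝐉 * lowerRows n) = -1 := by
  simp [weylRows, lowerRows, Matrix.J, fromBlocks_mul_fromRows,
    conjTranspose_fromRows_eq_fromCols_conjTranspose, fromCols_mul_fromRows]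

theorem lowerRows_J_lowerRows : (lowerRows n)ᴴ * (𝐉 * lowerRows n) = 0 := by
  simp [lowerRows, Matrix.J, fromBlocks_mul_fromRows,
    conjTranspose_fromRows_eq_fromCols_conjTranspose, fromCols_mul_fromRows]

/-- Multiplying by Y on the left and Z* on the right turns this into ψ χ* - φ ζ* = -Y J Z*, in which
M has cancelled: the Green matrix has the jump that variation of constants requires. -/
theorem weylRows_sub (M : Matrix (Fin n) (Fin n) ℂ) :
    weylRows M * (lowerRows n)ᴴ - lowerRows n * (weylRows Mᴴ)ᴴ = -𝐉 := by
  rw [weylRows, weylRows, lowerRows, conjTranspose_fromRows_eq_fromCols_conjTranspose,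
    conjTranspose_fromRows_eq_fromCols_conjTranspose, fromRows_mul_fromCols, fromRows_mul_fromCols]
  simp [Matrix.J, sub_eq_add_neg, fromBlocks_neg, fromBlocks_add]

/-- The initial value φ̂(t₀) = J (0; I) is neutral for 𝒰J, so solutions starting in its range have
zero initial energy. -/
theorem lowerRows_form (U : Matrix (Fin n) (Fin n) ℂ) :
    (𝐉 * lowerRows n)ᴴ * (bigU U * 𝐉 * (𝐉 * lowerRows n)) = 0 := by
  simp [lowerRows, bigU, Matrix.J, fromBlocks_multiply, fromBlocks_mul_fromRows,
    conjTranspose_fromRows_eq_fromCols_conjTranspose, fromCols_mul_fromRows]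

end Rows

theorem continuousOn_re_form {n : ℕ} {s : Set ℝ}
    {K : ℝ → Matrix (Fin n ⊕ Fin n) (Fin n ⊕ Fin n) ℂ} {y : ℝ → Fin n ⊕ Fin n → ℂ}
    (hK : ContinuousOn K s) (hy : ContinuousOn y s) :
    ContinuousOn (fun t => (star (y t) ⬝ᵥ (K t *ᵥ y t)).re) s := by
  have hc : Continuous fun p : Matrix (Fin n ⊕ Fin n) (Fin n ⊕ Fin n) ℂ × (Fin n ⊕ Fin n → ℂ) =>
      (star p.2 ⬝ᵥ (p.1 *ᵥ p.2)).re := by fun_prop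
  have h := hc.comp_continuousOn (hK.prodMk hy)
  exact h

namespace HamiltonianSystem

variable {n : ℕ} (S : HamiltonianSystem n)

local notation "𝐉" => Matrix.J (Fin n) ℂ
local notation "𝐏" => lowerProj n

theorem isSturmian : IsSturmian S.X S.t₀ :=
  ⟨S.isClosed_X, S.unbounded_X, S.t₀_mem, S.sturmian⟩

theorem posSemidef_A {t : ℝ} (ht : t ∈ S.T) : (S.A t).PosSemidef := S.A_nonneg t ht

theorem continuousOn_A : ContinuousOn S.A S.T := by
  have h1 := S.isSturmian.continuousOn_of_rdContinuous S.rd_A₁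
  have h2 := S.isSturmian.continuousOn_of_rdContinuous S.rd_A₂
  have hc : Continuous fun p : Matrix (Fin n) (Fin n) ℂ × Matrix (Fin n) (Fin n) ℂ =>
      fromBlocks p.1 0 0 p.2 := by fun_prop
  have h := hc.comp_continuousOn (h1.prodMk h2)
  exact h

theorem continuousOn_B : ContinuousOn S.B S.T := by
  have h1 := S.isSturmian.continuousOn_of_rdContinuous S.rd_B₁
  have h2 := S.isSturmian.continuousOn_of_rdContinuous S.rd_B₂
  have h3 := S.isSturmian.continuousOn_of_rdContinuous S.rd_B₃
  have h4 := S.isSturmian.continuousOn_of_rdContinuous S.rd_B₄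
  have hc : Continuous fun p : (Matrix (Fin n) (Fin n) ℂ × Matrix (Fin n) (Fin n) ℂ) ×
      Matrix (Fin n) (Fin n) ℂ × Matrix (Fin n) (Fin n) ℂ =>
      fromBlocks p.1.1 p.1.2 p.2.1 p.2.2 := by fun_prop
  have h := hc.comp_continuousOn ((h1.prodMk h2).prodMk (h3.prodMk h4))
  exact h

theorem continuousOn_coeff (lam : ℂ) : ContinuousOn (S.coeff lam) S.T :=
  (S.continuousOn_A.const_smul lam).add S.continuousOn_B

theorem continuousOn_adjCoeff (lam : ℂ) : ContinuousOn (S.adjCoeff lam) S.T :=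
  (S.continuousOn_A.const_smul (star lam)).add
    ((continuous_id.matrix_conjTranspose).comp_continuousOn S.continuousOn_B)

theorem coeff_conjTranspose (lam : ℂ) {t : ℝ} (ht : t ∈ S.T) :
    (S.coeff lam t)ᴴ = S.adjCoeff lam t := by
  rw [coeff, adjCoeff, conjTranspose_add, conjTranspose_smul, (S.posSemidef_A ht).isHermitian.eq]

theorem coeff_eq_fromBlocks (lam : ℂ) (t : ℝ) : S.coeff lam t =
    fromBlocks (lam • S.A₁ t + S.B₁ t) (S.B₂ t) (S.B₃ t) (lam • S.A₂ t + S.B₄ t) := by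
  simp [coeff, A, B, fromBlocks_smul, fromBlocks_add]

theorem coeff_eq_add (lam lam₀ : ℂ) (t : ℝ) :
    S.coeff lam t = S.coeff lam₀ t + (lam - lam₀) • S.A t := by
  rw [coeff, coeff, sub_smul]
  abel

theorem hatM_mul_const {k : Type*} (Y : ℝ → Matrix (Fin n ⊕ Fin n) (Fin n ⊕ Fin n) ℂ)
    (E : Matrix (Fin n ⊕ Fin n) k ℂ) (t : ℝ) : S.hatM (fun s => Y s * E) t = S.hatM Y t * E := by
  ext (i | i) j <;> simp [hatM, hat, Matrix.mul_apply]

theorem hatM_weylSolution (Y : ℝ → Matrix (Fin n ⊕ Fin n) (Fin n ⊕ Fin n) ℂ)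
    (M : Matrix (Fin n) (Fin n) ℂ) (t : ℝ) :
    S.hatM (weylSolution Y M) t = S.hatM Y t * weylRows M := by
  rw [← hatM_mul_const]
  congr 1
  exact funext (weylSolution_eq Y M)

theorem hatM_toCols₂ (Y : ℝ → Matrix (Fin n ⊕ Fin n) (Fin n ⊕ Fin n) ℂ) (t : ℝ) :
    S.hatM (fun s => (Y s).toCols₂) t = S.hatM Y t * lowerRows n := by
  rw [← hatM_mul_const]
  simp_rw [toCols₂_eq]

theorem hat_forwardJump (y : ℝ → Fin n ⊕ Fin n → ℂ) {t : ℝ} (ht : t ∈ S.T) (i : Fin n) :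
    S.hat y (forwardJump S.X t) (Sum.inr i) = y t (Sum.inr i) := by
  simp [hat, (S.sturmian t ht).2]

/-- The second component of y is that of ŷ composed with σ, and σ is continuous on a Sturmian
half-line. -/
theorem continuousOn_of_hat {y : ℝ → Fin n ⊕ Fin n → ℂ} (hy : ContinuousOn (S.hat y) S.T) :
    ContinuousOn y S.T := by
  refine continuousOn_pi.2 fun i => ?_
  rcases i with i | i
  · exact continuousOn_pi.1 hy (Sum.inl i)
  · refine ContinuousOn.congr (f := fun t => S.hat y (forwardJump S.X t) (Sum.inr i)) ?_
      fun t ht => (S.hat_forwardJump y ht i).symm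
    exact (continuousOn_pi.1 hy (Sum.inr i)).comp S.isSturmian.continuousOn_forwardJump
      fun t ht => S.isSturmian.forwardJump_mem ht

theorem lowerProj_mulVec_inl (v : Fin n ⊕ Fin n → ℂ) (i : Fin n) :
    (𝐏 *ᵥ v) (Sum.inl i) = 0 := by
  simp [lowerProj, fromBlocks_mulVec]

theorem lowerProj_mulVec_inr (v : Fin n ⊕ Fin n → ℂ) (i : Fin n) :
    (𝐏 *ᵥ v) (Sum.inr i) = v (Sum.inr i) := by
  simp [lowerProj, fromBlocks_mulVec]

variable {S}

/-- Converts the pointwise equation into integral form. Continuity of y comes first, since it makes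
the delta derivative continuous; the formula for y is the jump relation of ŷ read in the second
component. -/
theorem hasDensity_hat {C : ℝ → Matrix (Fin n ⊕ Fin n) (Fin n ⊕ Fin n) ℂ}
    (hC : ContinuousOn C S.T) {y : ℝ → Fin n ⊕ Fin n → ℂ}
    (hy : ∀ t ∈ S.T, S.SolvesAt C 0 y t) :
    HasDensity S.X S.t₀ (S.hat y) (fun t => -(𝐉 *ᵥ (C t *ᵥ y t))) ∧
    (∀ t ∈ S.T, y t = S.hat y t +
      (graininess S.X t : ℂ) • (𝐏 *ᵥ (-(𝐉 *ᵥ (C t *ᵥ y t))))) ∧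
    ContinuousOn y S.T := by
  have hder : ∀ t ∈ S.T, HasDeltaDerivAt S.X S.t₀ (S.hat y) (-(𝐉 *ᵥ (C t *ᵥ y t))) t := by
    intro t ht
    obtain ⟨d, hd, hJd⟩ := hy t ht
    have e : -(𝐉 *ᵥ (C t *ᵥ y t)) = d := by
      rw [Pi.zero_apply, add_zero] at hJd
      rw [← hJd, mulVec_mulVec, Matrix.J_squared, neg_mulVec, one_mulVec, neg_neg]
    rwa [e]
  have hyc : ContinuousOn y S.T := S.continuousOn_of_hat fun t ht =>
    (hder t ht).continuousWithinAt S.isSturmian ht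
  refine ⟨HasDensity.of_hasDeltaDerivAt S.isSturmian hder ?_, fun t ht => ?_, hyc⟩
  · have hc : Continuous fun p : Matrix (Fin n ⊕ Fin n) (Fin n ⊕ Fin n) ℂ ×
        (Fin n ⊕ Fin n → ℂ) => -(𝐉 *ᵥ (p.1 *ᵥ p.2)) := by fun_prop
    have h := hc.comp_continuousOn (hC.prodMk hyc)
    exact h
  · have e := (hder t ht).eq_add ht
    generalize -(𝐉 *ᵥ (C t *ᵥ y t)) = d at e
    ext (i | i)
    · rw [Pi.add_apply, Pi.smul_apply, lowerProj_mulVec_inl, smul_zero, add_zero]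
      rfl
    · rw [Pi.add_apply, Pi.smul_apply, lowerProj_mulVec_inr, ← S.hat_forwardJump y ht i, e,
        Pi.add_apply, Pi.smul_apply, Complex.real_smul, smul_eq_mul]

theorem IsFundamentalSystem.hasDensity {C Y : ℝ → Matrix (Fin n ⊕ Fin n) (Fin n ⊕ Fin n) ℂ}
    (hC : ContinuousOn C S.T) (hY : S.IsFundamentalSystem C Y) :
    MatHasDensity S.X S.t₀ (S.hatM Y) (fun t => -(𝐉 * (C t * Y t))) := fun i j =>
  (hasDensity_hat hC (hY.1 j)).1.clm_comp (ContinuousLinearMap.proj i)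

theorem IsFundamentalSystem.eq_hatM_add {C Y : ℝ → Matrix (Fin n ⊕ Fin n) (Fin n ⊕ Fin n) ℂ}
    (hC : ContinuousOn C S.T) (hY : S.IsFundamentalSystem C Y) {t : ℝ} (ht : t ∈ S.T) :
    Y t = S.hatM Y t + (graininess S.X t : ℂ) • (𝐏 * (-(𝐉 * (C t * Y t)))) := by
  ext i j
  exact congrFun ((hasDensity_hat hC (hY.1 j)).2.1 t ht) i

theorem IsFundamentalSystem.continuousOn {C Y : ℝ → Matrix (Fin n ⊕ Fin n) (Fin n ⊕ Fin n) ℂ}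
    (hC : ContinuousOn C S.T) (hY : S.IsFundamentalSystem C Y) : ContinuousOn Y S.T :=
  continuousOn_pi.2 fun i => continuousOn_pi.2 fun j =>
    continuousOn_pi.1 (hasDensity_hat hC (hY.1 j)).2.2 i

/-! ### A system and its adjoint: Lagrange identity and resolvent formula. -/

section Pair

variable {lam : ℂ} {Y Z : ℝ → Matrix (Fin n ⊕ Fin n) (Fin n ⊕ Fin n) ℂ}

theorem hasDensity_adjoint (hZ : S.IsFundamentalSystem (S.adjCoeff lam) Z) :
    MatHasDensity S.X S.t₀ (S.hatM Z) (fun t => -(𝐉 * ((S.coeff lam t)ᴴ * Z t))) :=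
  (hZ.hasDensity (S.continuousOn_adjCoeff lam)).congr S.isSturmian (fun _ _ => rfl)
    fun t ht => by rw [S.coeff_conjTranspose lam ht]

theorem eq_hatM_add_adjoint (hZ : S.IsFundamentalSystem (S.adjCoeff lam) Z) {t : ℝ}
    (ht : t ∈ S.T) : Z t = S.hatM Z t +
      (graininess S.X t : ℂ) • (𝐏 * (-(𝐉 * ((S.coeff lam t)ᴴ * Z t)))) := by
  rw [S.coeff_conjTranspose lam ht]
  exact hZ.eq_hatM_add (S.continuousOn_adjCoeff lam) ht

theorem hatM_lagrange_init (hY : S.IsFundamentalSystem (S.coeff lam) Y)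
    (hZ : S.IsFundamentalSystem (S.adjCoeff lam) Z) :
    (S.hatM Z S.t₀)ᴴ * (𝐉 * S.hatM Y S.t₀) = 𝐉 := by
  rw [hY.2, hZ.2, Matrix.J_squared, J_conjTranspose]
  simp

theorem hatM_lagrange (hY : S.IsFundamentalSystem (S.coeff lam) Y)
    (hZ : S.IsFundamentalSystem (S.adjCoeff lam) Z) {t : ℝ} (ht : t ∈ S.T) :
    (S.hatM Z t)ᴴ * (𝐉 * S.hatM Y t) = 𝐉 :=
  ((matHasDensity_lagrange S.isSturmian (hasDensity_adjoint hZ)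
    (hY.hasDensity (S.continuousOn_coeff lam)) (fun _ ht => eq_hatM_add_adjoint hZ ht)
    (fun _ ht => hY.eq_hatM_add (S.continuousOn_coeff lam) ht)).eq_of_zero S.isSturmian ht).trans
    (hatM_lagrange_init hY hZ)

/-- Variation of constants for the resolvent. -/
theorem exists_density_variation (hY : S.IsFundamentalSystem (S.coeff lam) Y)
    (hZ : S.IsFundamentalSystem (S.adjCoeff lam) Z) (M : Matrix (Fin n) (Fin n) ℂ) {ι : Type*}
    {G : ℝ → Matrix (Fin n ⊕ Fin n) ι ℂ} {F H : ℝ → Matrix (Fin n) ι ℂ}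
    (hF : MatHasDensity S.X S.t₀ F fun t => (Z t * lowerRows n)ᴴ * G t)
    (hH : MatHasDensity S.X S.t₀ H fun t => -((Z t * weylRows Mᴴ)ᴴ * G t)) :
    ∃ u', MatHasDensity S.X S.t₀
        (fun t => S.hatM Y t * (weylRows M * F t + lowerRows n * H t)) u' ∧
      ∀ t ∈ S.T,
        Y t * (weylRows M * F t + lowerRows n * H t) + S.N t * G t =
          S.hatM Y t * (weylRows M * F t + lowerRows n * H t) +
            (graininess S.X t : ℂ) • (𝐏 * u' t) ∧
        𝐉 * u' t = S.coeff lam t *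
          (Y t * (weylRows M * F t + lowerRows n * H t) + S.N t * G t) + G t := by
  have hk : MatHasDensity S.X S.t₀ (fun t => weylRows M * F t + lowerRows n * H t)
      (fun t => -(𝐉 * ((Z t)ᴴ * G t))) := by
    refine ((hF.const_mul S.isSturmian (weylRows M)).add
      (hH.const_mul S.isSturmian (lowerRows n))).congr S.isSturmian (fun _ _ => rfl) fun t _ => ?_
    rw [← Matrix.neg_mul 𝐉, ← weylRows_sub M, Matrix.mul_neg, ← sub_eq_add_neg, Matrix.sub_mul]
    simp only [conjTranspose_mul, Matrix.mul_assoc]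
  obtain ⟨u', V, hu', h⟩ := MatHasDensity.variation S.isSturmian (hasDensity_adjoint hZ)
    (hY.hasDensity (S.continuousOn_coeff lam)) (fun _ ht => eq_hatM_add_adjoint hZ ht)
    (fun _ ht => hY.eq_hatM_add (S.continuousOn_coeff lam) ht) (hatM_lagrange_init hY hZ) hk
  refine ⟨u', hu', fun t ht => ?_⟩
  obtain ⟨h1, h2, h3⟩ := h t ht
  rw [S.coeff_eq_fromBlocks] at h1
  have hN := smul_lowerProj_mul (S.isUnit_B₂ t ht) h1
  rw [hN] at h2
  refine ⟨h2.symm, ?_⟩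
  rw [h3, h2]
  rfl

end Pair

/-! ### Coercivity from admissibility and the sets Λ and Λ̃. -/

section Coercivity

variable {U : Matrix (Fin n) (Fin n) ℂ} {lam₀ lam : ℂ}

theorem re_form_coeff_ge (hadm : S.Admissible lam₀ U) {t : ℝ} (ht : t ∈ S.T)
    (v : Fin n ⊕ Fin n → ℂ) :
    (star v ⬝ᵥ (((lam - lam₀) • (bigU U * S.A t)) *ᵥ v)).re ≤
      (star v ⬝ᵥ (bigU U *ᵥ (S.coeff lam t *ᵥ v))).re := by
  have h := (hadm t ht).re_form_nonneg v
  rw [re_matRe_form] at h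
  rw [mulVec_mulVec, S.coeff_eq_add lam lam₀, Matrix.mul_add, Matrix.mul_smul, add_mulVec,
    dotProduct_add, Complex.add_re]
  linarith

theorem exists_coercive_of_mem_Lam (hadm : S.Admissible lam₀ U) (hlam : lam ∈ S.Lam lam₀ U) :
    ∃ δ : ℝ, 0 < δ ∧ ∀ t ∈ S.T, ∀ v,
      δ * (star ((bigU U)ᴴ *ᵥ v) ⬝ᵥ (S.A t *ᵥ ((bigU U)ᴴ *ᵥ v))).re ≤
        (star v ⬝ᵥ (bigU U *ᵥ (S.coeff lam t *ᵥ v))).re := by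
  obtain ⟨δ, hδ, h⟩ := hlam
  refine ⟨δ, hδ, fun t ht v => le_trans ?_ (re_form_coeff_ge hadm ht v)⟩
  have h1 := (h t ht).re_form_nonneg v
  rw [sub_mulVec, dotProduct_sub, Complex.sub_re, re_matRe_form, smul_mulVec (δ : ℂ),
    dotProduct_smul, smul_eq_mul, Complex.re_ofReal_mul] at h1
  rw [star_mulVec, conjTranspose_conjTranspose, ← dotProduct_mulVec, mulVec_mulVec, mulVec_mulVec]
  rw [Matrix.mul_assoc] at h1
  rw [Matrix.mul_assoc]
  linarith

/-- Evaluating the condition for Λ̃ at 𝒰* v cancels the inverses and leaves 𝒰A and A. -/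
theorem exists_coercive_of_mem_LamTilde (hU : IsUnit U) (hadm : S.Admissible lam₀ U)
    (hlam : lam ∈ S.LamTilde lam₀ U) :
    ∃ δ : ℝ, 0 < δ ∧ ∀ t ∈ S.T, ∀ v, δ * (star v ⬝ᵥ (S.A t *ᵥ v)).re ≤
        (star v ⬝ᵥ (bigU U *ᵥ (S.coeff lam t *ᵥ v))).re := by
  obtain ⟨δ, hδ, h⟩ := hlam
  refine ⟨δ, hδ, fun t ht v => le_trans ?_ (re_form_coeff_ge hadm ht v)⟩
  have h1 := (h t ht).re_form_nonneg ((bigU U)ᴴ *ᵥ v)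
  rw [sub_mulVec, dotProduct_sub, Complex.sub_re, re_matRe_form, smul_mulVec, smul_mulVec,
    dotProduct_smul, dotProduct_smul, smul_eq_mul, smul_eq_mul, Complex.re_ofReal_mul,
    star_mulVec, conjTranspose_conjTranspose, ← dotProduct_mulVec, ← dotProduct_mulVec,
    bigU_inv hU] at h1
  simp only [mulVec_mulVec] at h1
  rw [Matrix.mul_assoc (S.A t), bigU_inv_conjTranspose_mul hU, Matrix.mul_one,
    Matrix.mul_assoc _ _ (bigU U)ᴴ, bigU_inv_conjTranspose_mul hU, Matrix.mul_one,
    ← Matrix.mul_assoc, bigU_mul_inv hU, Matrix.one_mul] at h1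
  rw [smul_mulVec, dotProduct_smul, smul_eq_mul]
  linarith

/-- Insert the image of v under the adjoint of 𝒰⁻¹ into the bound from Λ and take the complex
conjugate: the coefficient becomes its adjoint and 𝒰A𝒰* becomes A. -/
theorem exists_coercive_adjoint (hU : IsUnit U) (hadm : S.Admissible lam₀ U)
    (hlam : lam ∈ S.Lam lam₀ U) :
    ∃ δ : ℝ, 0 < δ ∧ ∀ t ∈ S.T, ∀ v, δ * (star v ⬝ᵥ (S.A t *ᵥ v)).re ≤
        (star v ⬝ᵥ (bigU U⁻¹ *ᵥ (S.adjCoeff lam t *ᵥ v))).re := by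
  obtain ⟨δ, hδ, h⟩ := exists_coercive_of_mem_Lam hadm hlam
  refine ⟨δ, hδ, fun t ht v => ?_⟩
  have h1 := h t ht ((bigU U⁻¹)ᴴ *ᵥ v)
  have e1 : (bigU U)ᴴ *ᵥ ((bigU U⁻¹)ᴴ *ᵥ v) = v := by
    rw [mulVec_mulVec, mul_eq_one_comm.1 (bigU_inv_conjTranspose_mul hU), one_mulVec]
  rw [e1] at h1
  refine h1.trans (le_of_eq ?_)
  have e2 : star ((bigU U⁻¹)ᴴ *ᵥ v) ⬝ᵥ (bigU U *ᵥ (S.coeff lam t *ᵥ ((bigU U⁻¹)ᴴ *ᵥ v))) =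
      star v ⬝ᵥ ((bigU U⁻¹ * S.adjCoeff lam t)ᴴ *ᵥ v) := by
    rw [star_mulVec, conjTranspose_conjTranspose, ← dotProduct_mulVec, mulVec_mulVec,
      mul_eq_one_comm.1 (bigU_mul_inv hU), one_mulVec, conjTranspose_mul,
      ← S.coeff_conjTranspose lam ht, conjTranspose_conjTranspose, mulVec_mulVec]
  rw [e2, star_dotProduct_mulVec_comm, ← mulVec_mulVec, Complex.star_def, Complex.conj_re]

end Coercivity

end HamiltonianSystem

theorem IsSturmian.integrable_of_bounded {X : Set ℝ} {t₀ : ℝ} (h : IsSturmian X t₀) {β : ℝ → ℝ}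
    (hβ : ContinuousOn β (tsIci X t₀)) (hnn : ∀ t ∈ tsIci X t₀, 0 ≤ β t) {K t₁ : ℝ}
    (hK : ∀ b ∈ tsIci X t₀, t₁ ≤ b → ∫ t in Set.Ico t₀ b, β t ∂(deltaMeasure X t₀) ≤ K) :
    Integrable β (deltaMeasure X t₀) := by
  have hcov : AECover (deltaMeasure X t₀) atTop fun b : ℝ => Set.Ico t₀ b :=
    ⟨h.ae_mem.mono fun t ht => (eventually_gt_atTop t).mono fun b hb => ⟨ht.2, hb⟩,
      fun _ => measurableSet_Ico⟩
  refine hcov.integrable_of_integral_bounded_of_nonneg_ae K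
    (fun b => h.integrableOn_of_continuousOn hβ b) (h.ae_mem.mono hnn)
    (Eventually.of_forall fun x => ?_)
  obtain ⟨b, hb, hxb⟩ := h.exists_ge (max x t₁)
  refine le_trans (setIntegral_mono_set (h.integrableOn_of_continuousOn hβ b)
    (ae_restrict_of_ae (h.ae_mem.mono hnn)) ?_) (hK b hb ((le_max_right _ _).trans hxb))
  exact (Set.Ico_subset_Ico_right ((le_max_left _ _).trans hxb)).eventuallyLE

section MulVec

variable {m k : Type*} [Fintype m] [Fintype k] {μ : Measure ℝ} {q : ℝ → k → ℂ}

theorem MeasureTheory.Integrable.matrix_mulVec (hq : Integrable q μ) (K : Matrix m k ℂ) :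
    Integrable (fun s => K *ᵥ q s) μ :=
  (LinearMap.toContinuousLinearMap (Matrix.mulVecLin K)).integrable_comp hq

theorem integral_matrix_mulVec (hq : Integrable q μ) (K : Matrix m k ℂ) :
    ∫ s, K *ᵥ q s ∂μ = K *ᵥ ∫ s, q s ∂μ :=
  (LinearMap.toContinuousLinearMap (Matrix.mulVecLin K)).integral_comp_comm hq

end MulVec

namespace HamiltonianSystem

variable {n : ℕ} {S : HamiltonianSystem n}

local notation "𝐉" => Matrix.J (Fin n) ℂ
local notation "𝐏" => lowerProj n

theorem re_form_nonneg_A {t : ℝ} (ht : t ∈ S.T) (v : Fin n ⊕ Fin n → ℂ) :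
    0 ≤ (star v ⬝ᵥ (S.A t *ᵥ v)).re :=
  (S.posSemidef_A ht).re_form_nonneg v

theorem MemL2A.integrable_re {f : ℝ → Fin n ⊕ Fin n → ℂ} (hf : S.MemL2A f) :
    Integrable (fun t => (star (f t) ⬝ᵥ (S.A t *ᵥ f t)).re) S.vol := hf.2.re

theorem continuousOn_col {ι : Type*} {y : ℝ → Matrix (Fin n ⊕ Fin n) ι ℂ}
    (hy : ContinuousOn y S.T) (j : ι) : ContinuousOn (fun t => (y t).col j) S.T :=
  continuousOn_pi.2 fun i => continuousOn_pi.1 (continuousOn_pi.1 hy i) j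

theorem aestronglyMeasurable_dotProduct_mulVec {v : ℝ → Fin n ⊕ Fin n → ℂ}
    (hv : ContinuousOn v S.T) {f : ℝ → Fin n ⊕ Fin n → ℂ} (hf : S.MemL2A f) :
    AEStronglyMeasurable (fun t => star (v t) ⬝ᵥ (S.A t *ᵥ f t)) S.vol := by
  simp only [dotProduct, mulVec]
  refine Finset.aestronglyMeasurable_fun_sum _ fun i _ => ?_
  have hvi : AEStronglyMeasurable (fun t => v t i) S.vol :=
    S.isSturmian.aestronglyMeasurable_of_continuousOn (continuousOn_pi.1 hv i)
  refine hvi.star.mul (Finset.aestronglyMeasurable_fun_sum _ fun k _ => ?_)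
  have hA : AEStronglyMeasurable (fun t => S.A t i k) S.vol :=
    S.isSturmian.aestronglyMeasurable_of_continuousOn
      (continuousOn_pi.1 (continuousOn_pi.1 S.continuousOn_A i) k)
  exact hA.mul ((continuous_apply k).comp_aestronglyMeasurable hf.1)

theorem integrableOn_conjTranspose_mulVec {ι : Type*} [Fintype ι]
    {y : ℝ → Matrix (Fin n ⊕ Fin n) ι ℂ} (hy : ContinuousOn y S.T) {s : Set ℝ}
    (hys : ∀ j, IntegrableOn (fun t => (star ((y t).col j) ⬝ᵥ (S.A t *ᵥ (y t).col j)).re) s S.vol)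
    {f : ℝ → Fin n ⊕ Fin n → ℂ} (hf : S.MemL2A f) :
    IntegrableOn (fun t => (y t)ᴴ *ᵥ (S.A t *ᵥ f t)) s S.vol := by
  refine Integrable.of_eval fun j => ?_
  have hm : AEStronglyMeasurable (fun t => ((y t)ᴴ *ᵥ (S.A t *ᵥ f t)) j) (S.vol.restrict s) :=
    (aestronglyMeasurable_dotProduct_mulVec (continuousOn_col hy j) hf).restrict
  refine Integrable.mono' ((hys j).add hf.integrable_re.restrict) hm ?_
  filter_upwards [ae_restrict_of_ae S.isSturmian.ae_mem] with t ht
  have h1 := (S.posSemidef_A ht).two_norm_form_le ((y t).col j) (f t)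
  have h2 : ((y t)ᴴ *ᵥ (S.A t *ᵥ f t)) j = star ((y t).col j) ⬝ᵥ (S.A t *ᵥ f t) := rfl
  rw [h2]
  have h3 := norm_nonneg (star ((y t).col j) ⬝ᵥ (S.A t *ᵥ f t))
  simp only [Pi.add_apply]
  linarith

/-! ### Square integrability of the adjoint Weyl solution. -/

section Weyl

variable {U : Matrix (Fin n) (Fin n) ℂ} {lam₀ lam : ℂ}
  {Y Z : ℝ → Matrix (Fin n ⊕ Fin n) (Fin n ⊕ Fin n) ℂ} {M : Matrix (Fin n) (Fin n) ℂ}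

theorem hatM_weyl_orthogonal (hY : S.IsFundamentalSystem (S.coeff lam) Y)
    (hZ : S.IsFundamentalSystem (S.adjCoeff lam) Z) (M : Matrix (Fin n) (Fin n) ℂ)
    {t : ℝ} (ht : t ∈ S.T) :
    (S.hatM Z t * weylRows Mᴴ)ᴴ * (𝐉 * (S.hatM Y t * weylRows M)) = 0 := by
  rw [conjTranspose_mul, Matrix.mul_assoc, ← Matrix.mul_assoc 𝐉, ← Matrix.mul_assoc (S.hatM Z t)ᴴ,
    hatM_lagrange hY hZ ht, weylRows_J]

/-- Ẑ* J Ŷ = J makes Ŷ invertible, and the upper block of (I; M) is the identity. -/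
theorem hatM_weyl_injective (hY : S.IsFundamentalSystem (S.coeff lam) Y)
    (hZ : S.IsFundamentalSystem (S.adjCoeff lam) Z) {t : ℝ} (ht : t ∈ S.T) (a : Fin n → ℂ)
    (ha : (S.hatM Y t * weylRows M) *ᵥ a = 0) : a = 0 := by
  have h1 := congrArg (fun v => (S.hatM Z t)ᴴ *ᵥ (𝐉 *ᵥ v)) ha
  simp only [mulVec_mulVec, mulVec_zero] at h1
  rw [← Matrix.mul_assoc, ← Matrix.mul_assoc, Matrix.mul_assoc (S.hatM Z t)ᴴ,
    hatM_lagrange hY hZ ht] at h1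
  have h2 := congrArg (fun v => 𝐉 *ᵥ v) h1
  simp only [mulVec_mulVec, mulVec_zero, J_mul_J_mul, neg_mulVec, neg_eq_zero] at h2
  ext i
  simpa [weylRows, fromRows_mulVec] using congrFun h2 (Sum.inl i)

/-- Energy argument for the adjoint system with the form 𝒰⁻¹J: coercivity bounds the energy
increment below by 2δ ∫ ζ* A ζ, and the energy stays nonpositive after t₁. -/
theorem integrable_re_form_weyl (hU : IsUnit U) (hadm : S.Admissible lam₀ U)
    (hlam : lam ∈ S.Lam lam₀ U) (hY : S.IsFundamentalSystem (S.coeff lam) Y)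
    (hZ : S.IsFundamentalSystem (S.adjCoeff lam) Z) {t₁ : ℝ} (hM : M ∈ S.weylLimitSet U Y t₁)
    (j : Fin n) : Integrable (fun t => (star ((Z t * weylRows Mᴴ).col j) ⬝ᵥ
      (S.A t *ᵥ (Z t * weylRows Mᴴ).col j)).re) S.vol := by
  obtain ⟨δ, hδ, hcoer⟩ := exists_coercive_adjoint hU hadm hlam
  have hC := S.continuousOn_adjCoeff lam
  have hZc := hZ.continuousOn hC
  have hc : Continuous fun K : Matrix (Fin n ⊕ Fin n) (Fin n ⊕ Fin n) ℂ => K * weylRows Mᴴ := by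
    fun_prop
  have hζc : ContinuousOn (fun t => Z t * weylRows Mᴴ) S.T := hc.comp_continuousOn hZc
  have hβc := continuousOn_re_form S.continuousOn_A (continuousOn_col hζc j)
  have hd := ((hZ.hasDensity hC).mul_const S.isSturmian (weylRows Mᴴ)).energy S.isSturmian U⁻¹
    (C := S.adjCoeff lam) (y := fun t => Z t * weylRows Mᴴ) (G := fun _ => 0) (fun t ht => by
      conv_lhs => rw [hZ.eq_hatM_add hC ht]
      rw [Matrix.add_mul, Matrix.smul_mul, Matrix.mul_assoc]) (fun t _ => by
      rw [Matrix.neg_mul, Matrix.mul_neg, Matrix.mul_assoc 𝐉, J_mul_J_mul, neg_neg, add_zero,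
        Matrix.mul_assoc]) j
  -- The Weyl condition concerns ψ̂ and the form 𝒰J; Krein duality carries it over to ζ̂, the
  -- J-complement of ψ̂.
  have hq : ∀ b ∈ S.T, t₁ ≤ b → (((S.hatM Z b * weylRows Mᴴ)ᴴ *
      (bigU U⁻¹ * 𝐉 * (S.hatM Z b * weylRows Mᴴ))).diag j).re ≤ 0 := by
    intro b hb hle
    have h1 := Set.mem_iInter₂.1 hM b ⟨hb, hle⟩
    have h2 : (-((S.hatM Y b * weylRows M)ᴴ * (bigU U * 𝐉) *
        (S.hatM Y b * weylRows M))).PosSemidef := by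
      rw [← hatM_weylSolution]
      exact h1
    have h3 := re_form_nonpos_of_nonpos hU (fun a => hatM_weyl_injective hY hZ hb a)
      (hatM_weyl_orthogonal hY hZ M hb) h2 (Pi.single j 1)
    rw [mulVec_single_one] at h3
    exact h3
  set q0 := (((S.hatM Z S.t₀ * weylRows Mᴴ)ᴴ *
      (bigU U⁻¹ * 𝐉 * (S.hatM Z S.t₀ * weylRows Mᴴ))).diag j).re
  -- The bound comes from 2δ ∫ ζ* A ζ ≤ q(b) - q(t₀) ≤ -q(t₀).
  refine S.isSturmian.integrable_of_bounded hβc (fun t ht => re_form_nonneg_A ht _)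
    (K := (-q0) / (2 * δ)) (t₁ := t₁) fun b hb hle => ?_
  have h1 := hd.2 S.t₀ S.isSturmian.left_mem b hb hb.2
  rw [le_div_iff₀ (by positivity), mul_comm, ← integral_const_mul]
  refine le_trans (integral_mono_ae
    ((S.isSturmian.integrableOn_of_continuousOn hβc b).const_mul _) (hd.1 b) ?_)
    (h1.le.trans (by linarith [hq b hb hle]))
  filter_upwards [ae_restrict_of_ae S.isSturmian.ae_mem] with t ht
  have h2 := hcoer t ht ((Z t * weylRows Mᴴ).col j)
  have h3 : (0 : Matrix (Fin n ⊕ Fin n) (Fin n) ℂ).col j = 0 := rfl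
  rw [h3, add_zero]
  linarith

end Weyl

/-- Energy estimate for solutions of the inhomogeneous system. -/
theorem integral_re_form_le {U : Matrix (Fin n) (Fin n) ℂ} {lam : ℂ} {δ₁ δ₂ : ℝ} (hδ₁ : 0 < δ₁)
    (hc₁ : ∀ t ∈ S.T, ∀ v, δ₁ * (star ((bigU U)ᴴ *ᵥ v) ⬝ᵥ (S.A t *ᵥ ((bigU U)ᴴ *ᵥ v))).re ≤
      (star v ⬝ᵥ (bigU U *ᵥ (S.coeff lam t *ᵥ v))).re)
    (hc₂ : ∀ t ∈ S.T, ∀ v, δ₂ * (star v ⬝ᵥ (S.A t *ᵥ v)).re ≤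
      (star v ⬝ᵥ (bigU U *ᵥ (S.coeff lam t *ᵥ v))).re)
    {f : ℝ → Fin n ⊕ Fin n → ℂ} (hf : S.MemL2A f)
    {u u' y : ℝ → Matrix (Fin n ⊕ Fin n) Unit ℂ} (hu : MatHasDensity S.X S.t₀ u u')
    (hy : ∀ t ∈ S.T, y t = u t + (graininess S.X t : ℂ) • (𝐏 * u' t))
    (hsol : ∀ t ∈ S.T, 𝐉 * u' t = S.coeff lam t * y t + replicateCol Unit (S.A t *ᵥ f t))
    (hyc : ContinuousOn (fun t => (y t).col ()) S.T) {b : ℝ} (hb : b ∈ S.T)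
    (h0 : (((u S.t₀)ᴴ * (bigU U * 𝐉 * u S.t₀)).diag ()).re = 0)
    (hqb : (((u b)ᴴ * (bigU U * 𝐉 * u b)).diag ()).re ≤ 0) :
    δ₂ * ∫ t in Set.Ico S.t₀ b, (star ((y t).col ()) ⬝ᵥ (S.A t *ᵥ (y t).col ())).re ∂S.vol ≤
      δ₁⁻¹ * ∫ t, (star (f t) ⬝ᵥ (S.A t *ᵥ f t)).re ∂S.vol := by
  have hd := hu.energy S.isSturmian U hy hsol ()
  have h1 := hd.2 S.t₀ S.isSturmian.left_mem b hb hb.2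
  have hβ : IntegrableOn (fun t => (star ((y t).col ()) ⬝ᵥ (S.A t *ᵥ (y t).col ())).re)
      (Set.Ico S.t₀ b) S.vol :=
    S.isSturmian.integrableOn_of_continuousOn (continuousOn_re_form S.continuousOn_A hyc) b
  have hγ : IntegrableOn (fun t => (star (f t) ⬝ᵥ (S.A t *ᵥ f t)).re) (Set.Ico S.t₀ b) S.vol :=
    hf.integrable_re.integrableOn
  have h2 : δ₂ * ∫ t in Set.Ico S.t₀ b, (star ((y t).col ()) ⬝ᵥ (S.A t *ᵥ (y t).col ())).re ∂S.vol
      - δ₁⁻¹ * ∫ t in Set.Ico S.t₀ b, (star (f t) ⬝ᵥ (S.A t *ᵥ f t)).re ∂S.vol ≤ 0 := by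
    rw [← integral_const_mul, ← integral_const_mul,
      ← integral_sub (hβ.const_mul δ₂) (hγ.const_mul δ₁⁻¹)]
    refine le_trans (integral_mono_ae ((hβ.const_mul δ₂).sub (hγ.const_mul δ₁⁻¹)) (hd.1 b) ?_)
      (h1.le.trans (by linarith))
    filter_upwards [ae_restrict_of_ae S.isSturmian.ae_mem] with t ht
    have e1 := hc₁ t ht ((y t).col ())
    have e2 := hc₂ t ht ((y t).col ())
    -- Young's inequality with weight δ₁: the term in 𝒰* y is absorbed by the bound from Λ, while
    -- the bound from Λ̃ leaves δ₂ y* A y.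
    have e3 := (S.posSemidef_A ht).neg_le_two_re_form hδ₁ ((bigU U)ᴴ *ᵥ (y t).col ()) (f t)
    have e4 : (replicateCol Unit (S.A t *ᵥ f t)).col () = S.A t *ᵥ f t := rfl
    have e5 : star ((bigU U)ᴴ *ᵥ (y t).col ()) ⬝ᵥ (S.A t *ᵥ f t) =
        star ((y t).col ()) ⬝ᵥ (bigU U *ᵥ (S.A t *ᵥ f t)) := by
      rw [star_mulVec, conjTranspose_conjTranspose, ← dotProduct_mulVec]
    rw [e5] at e3
    rw [e4, mulVec_add, dotProduct_add, Complex.add_re]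
    linarith
  have h3 : ∫ t in Set.Ico S.t₀ b, (star (f t) ⬝ᵥ (S.A t *ᵥ f t)).re ∂S.vol ≤
      ∫ t, (star (f t) ⬝ᵥ (S.A t *ᵥ f t)).re ∂S.vol :=
    setIntegral_le_integral hf.integrable_re
      (S.isSturmian.ae_mem.mono fun t ht => re_form_nonneg_A ht _)
  have h4 := mul_le_mul_of_nonneg_left h3 (inv_nonneg.2 hδ₁.le)
  linarith

/-! ### The Green operator -/

section Green

variable {ψ φ χ ζ : ℝ → Matrix (Fin n ⊕ Fin n) (Fin n) ℂ} {f : ℝ → Fin n ⊕ Fin n → ℂ}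

/-- The diagonal point s = t belongs to the φ ζ* branch, and the N term lives on that point alone,
where the delta measure has an atom of mass μ(t). -/
theorem greenIntegrand_eq (t : ℝ) : S.greenIntegrand ψ φ χ ζ f t = fun s =>
    (Set.Iio t).indicator (fun s => ψ t *ᵥ ((χ s)ᴴ *ᵥ (S.A s *ᵥ f s))) s +
    (Set.Ici t).indicator (fun s => φ t *ᵥ ((ζ s)ᴴ *ᵥ (S.A s *ᵥ f s))) s +
    ({t} : Set ℝ).indicator (fun s =>
      ((graininess S.X t)⁻¹ : ℝ) • (S.N t *ᵥ (S.A s *ᵥ f s))) s := by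
  funext s
  rcases lt_trichotomy s t with h | h | h
  · simp [greenIntegrand, green, h, h.ne, -mulVec_mulVec, ← mulVec_mulVec]
  · subst h
    simp [greenIntegrand, green, diracDelta, add_mulVec, smul_mulVec, -mulVec_mulVec,
      ← mulVec_mulVec]
    rw [← Complex.ofReal_inv]
    exact Complex.coe_smul _ _
  · simp [greenIntegrand, green, diracDelta, h.le, h.ne', not_lt.2 h.le, -mulVec_mulVec,
      ← mulVec_mulVec]

theorem vol_singleton_lt_top (t : ℝ) : S.vol {t} < ⊤ :=
  (measure_mono fun s hs => by
    rw [Set.mem_singleton_iff.1 hs]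
    exact ⟨le_rfl, lt_add_one t⟩).trans_lt (S.isSturmian.deltaMeasure_Ico_lt_top t (t + 1))

theorem restrict_Iio (t : ℝ) : S.vol.restrict (Set.Iio t) = S.vol.restrict (Set.Ico S.t₀ t) := by
  refine Measure.restrict_congr_set ?_
  filter_upwards [S.isSturmian.ae_mem] with s hs
  exact propext ⟨fun h => ⟨hs.2, h⟩, fun h => h.2⟩

theorem integrable_green_parts
    (hχ : ∀ t, IntegrableOn (fun s => (χ s)ᴴ *ᵥ (S.A s *ᵥ f s)) (Set.Ico S.t₀ t) S.vol)
    (hζ : Integrable (fun s => (ζ s)ᴴ *ᵥ (S.A s *ᵥ f s)) S.vol) (t : ℝ) :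
    Integrable ((Set.Iio t).indicator
      (fun s => ψ t *ᵥ ((χ s)ᴴ *ᵥ (S.A s *ᵥ f s)))) S.vol ∧
    Integrable ((Set.Ici t).indicator
      (fun s => φ t *ᵥ ((ζ s)ᴴ *ᵥ (S.A s *ᵥ f s)))) S.vol ∧
    Integrable (({t} : Set ℝ).indicator (fun s =>
      ((graininess S.X t)⁻¹ : ℝ) • (S.N t *ᵥ (S.A s *ᵥ f s)))) S.vol := by
  refine ⟨?_, ?_, ?_⟩
  · rw [integrable_indicator_iff measurableSet_Iio, IntegrableOn, restrict_Iio]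
    exact Integrable.matrix_mulVec (hχ t) _
  · exact (hζ.matrix_mulVec _).indicator measurableSet_Ici
  · rw [integrable_indicator_iff (measurableSet_singleton t)]
    exact integrableOn_singleton (by simp) (vol_singleton_lt_top t)

theorem integrable_greenIntegrand
    (hχ : ∀ t, IntegrableOn (fun s => (χ s)ᴴ *ᵥ (S.A s *ᵥ f s)) (Set.Ico S.t₀ t) S.vol)
    (hζ : Integrable (fun s => (ζ s)ᴴ *ᵥ (S.A s *ᵥ f s)) S.vol) (t : ℝ) :
    Integrable (S.greenIntegrand ψ φ χ ζ f t) S.vol := by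
  obtain ⟨h1, h2, h3⟩ := integrable_green_parts (ψ := ψ) (φ := φ) hχ hζ t
  rw [greenIntegrand_eq]
  exact (h1.add h2).add h3

/-- At a right-dense point the singleton lies in intervals [t, s) of arbitrarily small mass; at a
right-scattered point it carries the mass of the whole gap. -/
theorem vol_real_singleton {t : ℝ} (ht : t ∈ S.T) : S.vol.real {t} = graininess S.X t := by
  rcases S.isSturmian.forwardJump_eq_or_lt t with hd | hd
  · rw [graininess, hd, sub_self, Measure.real, ENNReal.toReal_eq_zero_iff]
    refine Or.inl (le_antisymm (ENNReal.le_of_forall_pos_le_add fun ε hε _ => ?_) zero_le)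
    obtain ⟨s, hs, hts, hsx⟩ := S.isSturmian.exists_mem_Ioo ht hd
      (lt_add_of_pos_right t (NNReal.coe_pos.2 hε))
    refine (measure_mono (t := Set.Ico t s) fun r hr => ?_).trans ?_
    · rw [Set.mem_singleton_iff.1 hr]
      exact ⟨le_rfl, hts⟩
    · rw [vol, S.isSturmian.deltaMeasure_Ico ht hs, zero_add, ENNReal.ofReal_le_iff_le_toReal
        ENNReal.coe_ne_top, ENNReal.coe_toReal]
      linarith
  · have h1 := S.isSturmian.setIntegral_Ico_forwardJump ht (fun _ => (1 : ℝ))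
    rw [← S.isSturmian.restrict_inter, S.isSturmian.Ico_forwardJump_inter ht hd] at h1
    simpa [vol, Measure.real] using h1

/-- The atom μ(t) cancels the factor 1/μ(t) of the delta function, so N enters undamped; when μ(t) =
0 the matrix N(t) is zero and nothing is lost. -/
theorem greenOp_eq
    (hχ : ∀ t, IntegrableOn (fun s => (χ s)ᴴ *ᵥ (S.A s *ᵥ f s)) (Set.Ico S.t₀ t) S.vol)
    (hζ : Integrable (fun s => (ζ s)ᴴ *ᵥ (S.A s *ᵥ f s)) S.vol) {t : ℝ} (ht : t ∈ S.T) :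
    S.greenOp ψ φ χ ζ f t =
      ψ t *ᵥ (∫ s in Set.Ico S.t₀ t, (χ s)ᴴ *ᵥ (S.A s *ᵥ f s) ∂S.vol) +
      φ t *ᵥ (∫ s in Set.Ici t, (ζ s)ᴴ *ᵥ (S.A s *ᵥ f s) ∂S.vol) +
      S.N t *ᵥ (S.A t *ᵥ f t) := by
  obtain ⟨h1, h2, h3⟩ := integrable_green_parts (ψ := ψ) (φ := φ) hχ hζ t
  have h12 := h1.add h2
  rw [greenOp, greenIntegrand_eq]
  refine (integral_add h12 h3).trans ?_
  refine congrArg₂ _ ((integral_add h1 h2).trans ?_) ?_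
  · rw [integral_indicator measurableSet_Iio, integral_indicator measurableSet_Ici, restrict_Iio,
      integral_matrix_mulVec (hχ t), integral_matrix_mulVec hζ.integrableOn]
  · rw [integral_indicator (measurableSet_singleton t), integral_singleton, vol_real_singleton ht,
      smul_smul]
    rcases eq_or_ne (graininess S.X t) 0 with h0 | h0
    · simp [h0, N, fromBlocks_zero]
    · rw [mul_inv_cancel₀ h0, one_smul]

/-- All of the measure lies at or to the right of ρ(t₀), so only φ ζ* and the diagonal term can
contribute. The diagonal term matters only if ρ(t₀) = t₀; then t₀ is right-dense, μ(t₀) = 0, and the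
inverse is zero by convention. -/
theorem greenOp_backwardJump_inr
    (hχ : ∀ t, IntegrableOn (fun s => (χ s)ᴴ *ᵥ (S.A s *ᵥ f s)) (Set.Ico S.t₀ t) S.vol)
    (hζ : Integrable (fun s => (ζ s)ᴴ *ᵥ (S.A s *ᵥ f s)) S.vol) {i : Fin n}
    (hφ : ∀ j, φ (backwardJump S.X S.t₀) (Sum.inr i) j = 0) :
    S.greenOp ψ φ χ ζ f (backwardJump S.X S.t₀) (Sum.inr i) = 0 := by
  have hint := integrable_greenIntegrand (ψ := ψ) (φ := φ) hχ hζ (backwardJump S.X S.t₀)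
  rw [greenOp, eval_integral fun i => hint.eval i]
  refine integral_eq_zero_of_ae ?_
  filter_upwards [S.isSturmian.ae_mem] with s hs
  have hle : backwardJump S.X S.t₀ ≤ s := (IsSturmian.backwardJump_le _ _).trans hs.2
  rw [greenIntegrand_eq]
  set r := backwardJump S.X S.t₀ with hr
  have e1 : s ∉ Set.Iio r := not_lt.2 hle
  have e2 : (φ r *ᵥ ((ζ s)ᴴ *ᵥ (S.A s *ᵥ f s))) (Sum.inr i) = 0 := by
    simp [mulVec, dotProduct, hφ]
  have e3 : ({r} : Set ℝ).indicator (fun s =>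
      ((graininess S.X r)⁻¹ : ℝ) • (S.N r *ᵥ (S.A s *ᵥ f s))) s = 0 := by
    by_cases hsr : s = r
    · have hr0 : r = S.t₀ := le_antisymm (IsSturmian.backwardJump_le _ _) (hsr ▸ hs.2)
      have hσ := (S.sturmian S.t₀ S.isSturmian.left_mem).1
      rw [← hr, hr0] at hσ
      simp [hr0, graininess, hσ]
    · simp [hsr]
  dsimp only
  rw [Set.indicator_of_notMem e1, e3, zero_add, add_zero, Set.indicator_of_mem (Set.mem_Ici.2 hle)]
  exact e2

end Green

end HamiltonianSystem

/-! ### From truncated problems to the half-line. -/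

namespace HamiltonianSystem

variable {n : ℕ} {S : HamiltonianSystem n}

/-- Square integrability from energy bounds for truncated problems. -/
theorem integrable_re_form_of_shift {y : ℝ → Fin n ⊕ Fin n → ℂ} (hy : ContinuousOn y S.T)
    {φ : ℝ → Matrix (Fin n ⊕ Fin n) (Fin n) ℂ} (hφ : ContinuousOn φ S.T)
    {H : ℝ → Fin n → ℂ} (hH : Tendsto H (atTop ⊓ 𝓟 S.T) (𝓝 0)) {K t₁ : ℝ}
    (hK : ∀ b ∈ S.T, t₁ ≤ b → ∫ t in Set.Ico S.t₀ b,
      (star (y t - φ t *ᵥ H b) ⬝ᵥ (S.A t *ᵥ (y t - φ t *ᵥ H b))).re ∂S.vol ≤ K) :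
    Integrable (fun t => (star (y t) ⬝ᵥ (S.A t *ᵥ y t)).re) S.vol := by
  choose b hbT hbm using fun m : ℕ => S.isSturmian.exists_ge (max t₁ m)
  have hb : Tendsto b atTop (atTop ⊓ 𝓟 S.T) := by
    refine tendsto_inf.2 ⟨tendsto_atTop_mono (fun m => (le_max_right _ _).trans (hbm m))
      tendsto_natCast_atTop_atTop, tendsto_principal.2 (Eventually.of_forall hbT)⟩
  set β : ℕ → ℝ → ℝ := fun m t =>
    (star (y t - φ t *ᵥ H (b m)) ⬝ᵥ (S.A t *ᵥ (y t - φ t *ᵥ H (b m)))).re with hβ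
  have hβc : ∀ m, ContinuousOn (β m) S.T := fun m => by
    refine continuousOn_re_form S.continuousOn_A (hy.sub ?_)
    have hc : Continuous fun K : Matrix (Fin n ⊕ Fin n) (Fin n) ℂ => K *ᵥ H (b m) := by fun_prop
    exact hc.comp_continuousOn hφ
  have hβi : ∀ m, IntegrableOn (β m) (Set.Ico S.t₀ (b m)) S.vol := fun m =>
    S.isSturmian.integrableOn_of_continuousOn (hβc m) _
  have hβnn : ∀ m, ∀ᵐ t ∂S.vol, 0 ≤ β m t := fun m =>
    S.isSturmian.ae_mem.mono fun t ht => re_form_nonneg_A ht _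
  -- Fatou: the shifted forms, cut off at b(m), converge pointwise because H(b(m)) → 0, and their
  -- integrals are at most K.
  refine integrable_of_tendsto (G := fun m => (Set.Ico S.t₀ (b m)).indicator (β m)) ?_
    (fun m => ((hβi m).integrable_indicator measurableSet_Ico).1) ?_
  · filter_upwards [S.isSturmian.ae_mem] with t ht
    have h1 : Tendsto (fun m => β m t) atTop (𝓝 (star (y t) ⬝ᵥ (S.A t *ᵥ y t)).re) := by
      have hc : Continuous fun c : Fin n → ℂ =>
          (star (y t - φ t *ᵥ c) ⬝ᵥ (S.A t *ᵥ (y t - φ t *ᵥ c))).re := by fun_prop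
      have h2 := (hc.tendsto 0).comp (hH.comp hb)
      rw [mulVec_zero, sub_zero] at h2
      exact h2
    refine h1.congr' ?_
    have hb' := (tendsto_inf.1 hb).1
    filter_upwards [hb'.eventually_gt_atTop t] with m hm
    rw [Set.indicator_of_mem]
    exact ⟨ht.2, hm⟩
  · refine ne_top_of_le_ne_top (ENNReal.ofReal_ne_top (r := K)) ?_
    refine liminf_le_of_frequently_le' (Eventually.frequently (Eventually.of_forall fun m => ?_))
    rw [← ofReal_integral_norm_eq_lintegral_enorm ((hβi m).integrable_indicator measurableSet_Ico)]
    refine ENNReal.ofReal_le_ofReal ?_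
    refine le_trans (le_of_eq ?_) (hK (b m) (hbT m) ((le_max_left _ _).trans (hbm m)))
    simp_rw [norm_indicator_eq_indicator_norm]
    rw [integral_indicator measurableSet_Ico]
    refine integral_congr_ae ?_
    filter_upwards [ae_restrict_of_ae (hβnn m)] with t ht
    exact Real.norm_of_nonneg ht

theorem memL2A_of_integrable_re {y : ℝ → Fin n ⊕ Fin n → ℂ} (hy : ContinuousOn y S.T)
    (hint : Integrable (fun t => (star (y t) ⬝ᵥ (S.A t *ᵥ y t)).re) S.vol) : S.MemL2A y := by
  refine ⟨S.isSturmian.aestronglyMeasurable_of_continuousOn hy, hint.ofReal.congr ?_⟩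
  filter_upwards [S.isSturmian.ae_mem] with t ht
  exact ((S.posSemidef_A ht).form_eq_re (y t)).symm

end HamiltonianSystem

/-! ### The resolvent lemma. -/

open HamiltonianSystem

theorem mainTheorem6 {n : ℕ} (S : HamiltonianSystem n)
    (U : Matrix (Fin n) (Fin n) ℂ) (hU : IsUnit U)
    (lam₀ : ℂ) (hadm : S.Admissible lam₀ U)
    (lam : ℂ) (hlam : lam ∈ S.Lam lam₀ U ∩ S.LamTilde lam₀ U)
    (Y Z : ℝ → Matrix (Fin n ⊕ Fin n) (Fin n ⊕ Fin n) ℂ)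
    (hY : S.IsFundamentalSystem (S.coeff lam) Y)
    (hZ : S.IsFundamentalSystem (S.adjCoeff lam) Z)
    (t₁ : ℝ) (M : Matrix (Fin n) (Fin n) ℂ) (hM : M ∈ S.weylLimitSet U Y t₁)
    (φ χ ψ ζ : ℝ → Matrix (Fin n ⊕ Fin n) (Fin n) ℂ)
    (hφ : φ = fun t => (Y t).toCols₂) (hχ : χ = fun t => (Z t).toCols₂)
    (hψ : ψ = weylSolution Y M) (hζ : ζ = weylSolution Z Mᴴ)
    (f : ℝ → Fin n ⊕ Fin n → ℂ) (hf : S.MemL2A f)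
    (Rf : ℝ → Fin n ⊕ Fin n → ℂ) (hRf : Rf = S.greenOp ψ φ χ ζ f) :
    -- the integrals defining `R_λ f` converge
    (∀ t ∈ insert (backwardJump S.X S.t₀) S.T,
      Integrable (S.greenIntegrand ψ φ χ ζ f t) S.vol) ∧
    -- `R_λ f` solves the inhomogeneous system
    S.IsInhomogeneousSolution (S.coeff lam) f Rf ∧
    -- boundary conditions at `t₀`
    (∀ i, Rf (backwardJump S.X S.t₀) (Sum.inr i) = 0) ∧
    (S.hatM χ S.t₀)ᴴ *ᵥ (Matrix.J (Fin n) ℂ *ᵥ S.hat Rf S.t₀) = 0 ∧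
    -- boundary condition at infinity
    Tendsto (fun t => (S.hatM ζ t)ᴴ *ᵥ (Matrix.J (Fin n) ℂ *ᵥ S.hat Rf t))
      (atTop ⊓ 𝓟 S.T) (𝓝 0) ∧
    -- explicit formula for the shifted function
    Integrable (fun s => (ζ s)ᴴ *ᵥ (S.A s *ᵥ f s)) S.vol ∧
    (∀ t ∈ S.T,
      IntegrableOn (fun s => (χ s)ᴴ *ᵥ (S.A s *ᵥ f s)) (Set.Ico S.t₀ t) S.vol ∧
      S.hat Rf t =
        S.hatM ψ t *ᵥ (∫ s in Set.Ico S.t₀ t, (χ s)ᴴ *ᵥ (S.A s *ᵥ f s) ∂S.vol) +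
        S.hatM φ t *ᵥ (∫ s in Set.Ici t, (ζ s)ᴴ *ᵥ (S.A s *ᵥ f s) ∂S.vol)) := by
  have hS := S.isSturmian
  obtain ⟨δ₁, hδ₁, hc₁⟩ := exists_coercive_of_mem_Lam hadm hlam.1
  obtain ⟨δ₂, hδ₂, hc₂⟩ := exists_coercive_of_mem_LamTilde hU hadm hlam.2
  have hYc := hY.continuousOn (S.continuousOn_coeff lam)
  have hZc := hZ.continuousOn (S.continuousOn_adjCoeff lam)
  have hcE : ∀ E : Matrix (Fin n ⊕ Fin n) (Fin n) ℂ, Continuous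
      fun K : Matrix (Fin n ⊕ Fin n) (Fin n ⊕ Fin n) ℂ => K * E := fun E => by fun_prop
  have hφt : ∀ t, φ t = Y t * lowerRows n := fun t => by rw [hφ]; exact toCols₂_eq _
  have hχt : ∀ t, χ t = Z t * lowerRows n := fun t => by rw [hχ]; exact toCols₂_eq _
  have hψt : ∀ t, ψ t = Y t * weylRows M := fun t => by rw [hψ]; exact weylSolution_eq _ _ _
  have hζt : ∀ t, ζ t = Z t * weylRows Mᴴ := fun t => by rw [hζ]; exact weylSolution_eq _ _ _
  have hφh : ∀ t, S.hatM φ t = S.hatM Y t * lowerRows n := fun t => by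
    rw [hφ]; exact S.hatM_toCols₂ _ _
  have hχh : ∀ t, S.hatM χ t = S.hatM Z t * lowerRows n := fun t => by
    rw [hχ]; exact S.hatM_toCols₂ _ _
  have hψh : ∀ t, S.hatM ψ t = S.hatM Y t * weylRows M := fun t => by
    rw [hψ]; exact S.hatM_weylSolution _ _ _
  have hζh : ∀ t, S.hatM ζ t = S.hatM Z t * weylRows Mᴴ := fun t => by
    rw [hζ]; exact S.hatM_weylSolution _ _ _
  have hφc : ContinuousOn φ S.T := ((hcE (lowerRows n)).comp_continuousOn hYc).congr
    fun t _ => hφt t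
  have hχc : ContinuousOn χ S.T := ((hcE (lowerRows n)).comp_continuousOn hZc).congr
    fun t _ => hχt t
  have hζc : ContinuousOn ζ S.T := ((hcE (weylRows Mᴴ)).comp_continuousOn hZc).congr
    fun t _ => hζt t
  -- integrability of `χ* A f` and `ζ* A f`
  have hχi : ∀ t, IntegrableOn (fun s => (χ s)ᴴ *ᵥ (S.A s *ᵥ f s)) (Set.Ico S.t₀ t) S.vol :=
    fun t => integrableOn_conjTranspose_mulVec hχc (fun j => hS.integrableOn_of_continuousOn
      (continuousOn_re_form S.continuousOn_A (continuousOn_col hχc j)) t) hf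
  have hζi : Integrable (fun s => (ζ s)ᴴ *ᵥ (S.A s *ᵥ f s)) S.vol := by
    rw [← integrableOn_univ]
    refine integrableOn_conjTranspose_mulVec hζc (fun j => ?_) hf
    rw [integrableOn_univ]
    simp_rw [hζt]
    exact integrable_re_form_weyl hU hadm hlam.1 hY hZ hM j
  set F : ℝ → Fin n → ℂ := fun t => ∫ s in Set.Ico S.t₀ t, (χ s)ᴴ *ᵥ (S.A s *ᵥ f s) ∂S.vol with hF
  set H : ℝ → Fin n → ℂ := fun t => ∫ s in Set.Ici t, (ζ s)ᴴ *ᵥ (S.A s *ᵥ f s) ∂S.vol with hH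
  have hFd : HasDensity S.X S.t₀ F fun s => (χ s)ᴴ *ᵥ (S.A s *ᵥ f s) :=
    HasDensity.primitive hS hχi
  have hHd : HasDensity S.X S.t₀ H fun s => -((ζ s)ᴴ *ᵥ (S.A s *ᵥ f s)) := by
    refine ⟨fun b => hζi.integrableOn.neg, fun s _ t _ hst => ?_⟩
    have h1 : H s = ∫ r in Set.Ico s t, (ζ r)ᴴ *ᵥ (S.A r *ᵥ f r) ∂S.vol + H t := by
      simp only [hH]
      rw [← Set.Ico_union_Ici_eq_Ici hst]
      refine setIntegral_union ?_ measurableSet_Ici hζi.integrableOn hζi.integrableOn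
      rw [Set.disjoint_left]
      exact fun x hx hx' => absurd hx.2 (not_lt.2 hx')
    rw [integral_neg, h1, sub_add_cancel_right]
    rfl
  have hHlim : Tendsto H atTop (𝓝 0) := by
    have h1 := tendsto_setIntegral_of_antitone (μ := S.vol) (s := fun t : ℝ => Set.Ici t)
      (f := fun s => (ζ s)ᴴ *ᵥ (S.A s *ᵥ f s)) (fun t => measurableSet_Ici)
      (fun a b hab => Set.Ici_subset_Ici.2 hab) ⟨0, hζi.integrableOn⟩
    have h2 : ⋂ t : ℝ, Set.Ici t = ∅ := by
      ext x
      simp only [Set.mem_iInter, Set.mem_Ici, Set.mem_empty_iff_false, iff_false, not_forall,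
        not_le]
      exact exists_gt x
    rw [h2, setIntegral_empty] at h1
    exact h1
  set G : ℝ → Matrix (Fin n ⊕ Fin n) Unit ℂ := fun t => replicateCol Unit (S.A t *ᵥ f t) with hG
  have hFm : MatHasDensity S.X S.t₀ (fun t => replicateCol Unit (F t))
      fun t => (Z t * lowerRows n)ᴴ * G t := fun i j => by
    simp_rw [← hχt]
    exact hFd.clm_comp (ContinuousLinearMap.proj i)
  -- The density of H does not see the constant c: c = 0 gives the resolvent itself, and c = H(b)
  -- the solution adapted to the truncation at b.
  have hHm : ∀ c : Fin n → ℂ, MatHasDensity S.X S.t₀ (fun t => replicateCol Unit (H t - c))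
      fun t => -((Z t * weylRows Mᴴ)ᴴ * G t) := fun c i j => by
    simp_rw [← hζt]
    have h1 := (hHd.add (HasDensity.const (-c))).clm_comp (ContinuousLinearMap.proj i)
    refine h1.congr hS (fun t _ => ?_) (fun t _ => ?_)
    · simp [sub_eq_add_neg]
    · rw [add_zero]
      rfl
  have hcol : ∀ (K : Matrix (Fin n ⊕ Fin n) (Fin n ⊕ Fin n) ℂ) (a c : Fin n → ℂ),
      K * (weylRows M * replicateCol Unit a + lowerRows n * replicateCol Unit c) =
        replicateCol Unit ((K * weylRows M) *ᵥ a + (K * lowerRows n) *ᵥ c) := fun K a c => by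
    rw [Matrix.mul_add, ← Matrix.mul_assoc, ← Matrix.mul_assoc, replicateCol_add,
      replicateCol_mulVec, replicateCol_mulVec]
  have hRt : ∀ t ∈ S.T, Rf t = ψ t *ᵥ F t + φ t *ᵥ H t + S.N t *ᵥ (S.A t *ᵥ f t) :=
    fun t ht => by rw [hRf]; exact greenOp_eq hχi hζi ht
  have hyc : ∀ (c : Fin n → ℂ), ∀ t ∈ S.T,
      Y t * (weylRows M * replicateCol Unit (F t) + lowerRows n * replicateCol Unit (H t - c)) +
        S.N t * G t = replicateCol Unit (Rf t - φ t *ᵥ c) := fun c t ht => by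
    rw [hcol, hG, ← replicateCol_mulVec, ← replicateCol_add, hRt t ht, hψt, hφt, mulVec_sub]
    congr 1
    abel
  have hF0 : F S.t₀ = 0 := by simp [hF]
  have hφ0 : ∀ i j, S.hatM φ S.t₀ (Sum.inr i) j = 0 := fun i j => by
    rw [hφh, hY.2]
    simp [lowerRows, Matrix.J, fromBlocks_mul_fromRows]
  have hR0 : ∀ i, Rf (backwardJump S.X S.t₀) (Sum.inr i) = 0 := fun i => by
    rw [hRf]
    exact greenOp_backwardJump_inr hχi hζi fun j => hφ0 i j
  -- the partially shifted function
  obtain ⟨u', hu', hsol⟩ := exists_density_variation hY hZ M hFm (hHm 0)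
  -- In the second component the value at r = ρ(t) is (u + μ P u')(r), which is u at σ(r) = t.
  have hhat : ∀ t ∈ S.T, S.hat Rf t = S.hatM ψ t *ᵥ F t + S.hatM φ t *ᵥ H t := by
    intro t ht
    ext (i | i)
    · change Rf t (Sum.inl i) = _
      rw [hRt t ht]
      have h1 : (S.N t *ᵥ (S.A t *ᵥ f t)) (Sum.inl i) = 0 := by
        simp [N, fromBlocks_mulVec, -mulVec_mulVec]
      rw [Pi.add_apply, h1, add_zero]
      rfl
    · change Rf (backwardJump S.X t) (Sum.inr i) = _
      by_cases hr : backwardJump S.X t ∈ S.T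
      · set r := backwardJump S.X t with hrdef
        have hσ : forwardJump S.X r = t := (S.sturmian t ht).1
        have h1 := (hsol r hr).1
        have h2 := hu'.eq_add hS hr
        rw [hyc 0 r hr, mulVec_zero, sub_zero] at h1
        simp only [sub_zero] at h1 h2
        have h3 := congrFun (congrFun h1 (Sum.inr i)) ()
        have h4 := congrFun (congrFun h2 (Sum.inr i)) ()
        have h5 : (lowerProj n * u' r) (Sum.inr i) () = u' r (Sum.inr i) () :=
          lowerProj_mulVec_inr (fun k => u' r k ()) i
        rw [hσ, Matrix.add_apply, Matrix.smul_apply, hcol, hcol, ← hψh, ← hφh, ← hψh, ← hφh] at h4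
        rw [hcol, Matrix.add_apply, Matrix.smul_apply, h5, ← hψh, ← hφh] at h3
        exact h3.trans h4.symm
      -- Leaving the half-line under ρ is possible only at t₀; there F vanishes and so does the
      -- second component of φ̂, in agreement with the first boundary condition.
      · have ht0 : t = S.t₀ := by
          by_contra hne
          exact hr (hS.backwardJump_mem_of_lt ht (lt_of_le_of_ne ht.2 (Ne.symm hne)))
        have h1 : (S.hatM φ t *ᵥ H t) (Sum.inr i) = 0 := by
          rw [ht0]
          simp [mulVec, dotProduct, hφ0]
        rw [Pi.add_apply, h1, ht0, hF0, mulVec_zero]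
        simpa using hR0 i
  have hRd : HasDensity S.X S.t₀ (S.hat Rf) (fun t i => u' t i ()) := by
    refine HasDensity.congr hS (HasDensity.pi
      (u := fun t => S.hatM ψ t *ᵥ F t + S.hatM φ t *ᵥ H t) fun i => ?_)
      (fun t ht => (hhat t ht).symm) (fun _ _ => rfl)
    have h1 := hu' i ()
    simp only [hcol, sub_zero, ← hψh, ← hφh] at h1
    exact h1
  have hRc : ContinuousOn Rf S.T := S.continuousOn_of_hat (hRd.continuousOn hS)
  have heq : ∀ t ∈ S.T, Matrix.J (Fin n) ℂ *ᵥ (fun i => u' t i ()) =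
      S.coeff lam t *ᵥ Rf t + S.A t *ᵥ f t := fun t ht => by
    have h1 := (hsol t ht).2
    rw [hyc 0 t ht, mulVec_zero, sub_zero] at h1
    ext i
    exact congrFun (congrFun h1 i) ()
  -- square integrability
  have hR2 : S.MemL2A Rf := by
    refine memL2A_of_integrable_re hRc (integrable_re_form_of_shift hRc hφc
      (hHlim.mono_left inf_le_left)
      (K := δ₂⁻¹ * (δ₁⁻¹ * ∫ t, (star (f t) ⬝ᵥ (S.A t *ᵥ f t)).re ∂S.vol)) (t₁ := t₁)
      fun b hb hle => ?_)
    -- Subtracting H(b) from H subtracts φ H(b), a homogeneous solution, from R_λ f.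
    obtain ⟨v', hv', hvsol⟩ := exists_density_variation hY hZ M hFm (hHm (H b))
    have hcb : Continuous fun K : Matrix (Fin n ⊕ Fin n) (Fin n) ℂ => K *ᵥ H b := by fun_prop
    have hcc : ContinuousOn (fun t => Rf t - φ t *ᵥ H b) S.T :=
      hRc.sub (hcb.comp_continuousOn hφc)
    have hYcol : ∀ t ∈ S.T, (Y t * (weylRows M * replicateCol Unit (F t) +
        lowerRows n * replicateCol Unit (H t - H b)) + S.N t * G t).col () =
        Rf t - φ t *ᵥ H b := fun t ht => by
      rw [hyc (H b) t ht]
      rfl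
    have h0 : (((S.hatM Y S.t₀ * (weylRows M * replicateCol Unit (F S.t₀) +
        lowerRows n * replicateCol Unit (H S.t₀ - H b)))ᴴ * (bigU U * Matrix.J (Fin n) ℂ *
        (S.hatM Y S.t₀ * (weylRows M * replicateCol Unit (F S.t₀) +
        lowerRows n * replicateCol Unit (H S.t₀ - H b))))).diag ()).re = 0 := by
      have e : ∀ R : Matrix (Fin n) Unit ℂ, (Matrix.J (Fin n) ℂ * (lowerRows n * R))ᴴ *
          (bigU U * Matrix.J (Fin n) ℂ * (Matrix.J (Fin n) ℂ * (lowerRows n * R))) =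
          Rᴴ * ((Matrix.J (Fin n) ℂ * lowerRows n)ᴴ *
            (bigU U * Matrix.J (Fin n) ℂ * (Matrix.J (Fin n) ℂ * lowerRows n))) * R := fun R => by
        simp only [conjTranspose_mul, Matrix.mul_assoc]
      rw [hF0, replicateCol_zero, Matrix.mul_zero, zero_add, hY.2, e, lowerRows_form]
      simp
    -- At b the φ̂ part is gone and only ψ̂(b) F(b) remains, so the hypothesis on M at the point b
    -- applies directly.
    have hqb : (((S.hatM Y b * (weylRows M * replicateCol Unit (F b) +
        lowerRows n * replicateCol Unit (H b - H b)))ᴴ * (bigU U * Matrix.J (Fin n) ℂ *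
        (S.hatM Y b * (weylRows M * replicateCol Unit (F b) +
        lowerRows n * replicateCol Unit (H b - H b))))).diag ()).re ≤ 0 := by
      have h1 := (Set.mem_iInter₂.1 hM b ⟨hb, hle⟩).re_form_nonneg (F b)
      rw [hatM_weylSolution] at h1
      rw [hcol, sub_self, mulVec_zero, add_zero, diag_apply, conjTranspose_mul_mul_apply]
      rw [neg_mulVec, dotProduct_neg, Complex.neg_re, Matrix.mul_assoc, ← mulVec_mulVec,
        ← mulVec_mulVec, dotProduct_mulVec, ← star_mulVec] at h1
      exact neg_nonneg.1 h1
    have h1 := integral_re_form_le hδ₁ hc₁ hc₂ hf hv' (fun t ht => (hvsol t ht).1)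
      (fun t ht => (hvsol t ht).2) (hcc.congr hYcol) hb h0 hqb
    have h2 := (le_inv_mul_iff₀ hδ₂).2 h1
    refine le_trans (le_of_eq (integral_congr_ae ?_)) h2
    filter_upwards [ae_restrict_of_ae hS.ae_mem] with t ht
    rw [hYcol t ht]
  have hlag : ∀ t ∈ S.T, ∀ P Q : Matrix (Fin n ⊕ Fin n) (Fin n) ℂ,
      (S.hatM Z t * P)ᴴ * Matrix.J (Fin n) ℂ * (S.hatM Y t * Q) =
        Pᴴ * (Matrix.J (Fin n) ℂ * Q) := fun t ht P Q => by
    conv_rhs => rw [← hatM_lagrange hY hZ ht]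
    simp only [conjTranspose_mul, Matrix.mul_assoc]
  refine ⟨fun t _ => integrable_greenIntegrand hχi hζi t,
    ⟨hR2, hRd.locallyAC hS, ?_, fun t ht hc => ?_⟩, hR0, ?_, ?_, hζi,
    fun t ht => ⟨hχi t, hhat t ht⟩⟩
  · filter_upwards [hRd.ae_hasDeltaDerivAt hS, hS.ae_mem] with t ht htT
    exact ⟨_, ht, heq t htT⟩
  · refine ⟨_, hRd.hasDeltaDerivAt hS ht ?_, heq t ht⟩
    have hcJ : Continuous fun p : (Matrix (Fin n ⊕ Fin n) (Fin n ⊕ Fin n) ℂ ×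
        (Fin n ⊕ Fin n → ℂ)) × (Fin n ⊕ Fin n → ℂ) =>
        -(Matrix.J (Fin n) ℂ *ᵥ (p.1.1 *ᵥ p.1.2 + p.2)) := by fun_prop
    have h1 := hcJ.continuousAt.comp_continuousWithinAt
      (((S.continuousOn_coeff lam t ht).prodMk (hRc t ht)).prodMk hc)
    have h2 : ∀ s ∈ S.T, (fun i => u' s i ()) =
        -(Matrix.J (Fin n) ℂ *ᵥ (S.coeff lam s *ᵥ Rf s + S.A s *ᵥ f s)) := fun s hs => by
      rw [← heq s hs, mulVec_mulVec, Matrix.J_squared, neg_mulVec, one_mulVec, neg_neg]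
    exact ContinuousWithinAt.congr h1 h2 (h2 t ht)
  · rw [hhat _ hS.left_mem, hF0, mulVec_zero, zero_add, hχh, hφh, mulVec_mulVec, mulVec_mulVec,
      hlag _ hS.left_mem, lowerRows_J_lowerRows, zero_mulVec]
  -- By the Lagrange identity ζ̂* J ψ̂ = 0 and ζ̂* J φ̂ = -I, so the boundary form equals -H(t).
  · have h1 : Tendsto (fun t => -H t) (atTop ⊓ 𝓟 S.T) (𝓝 0) := by
      have h2 := (hHlim.mono_left inf_le_left : Tendsto H (atTop ⊓ 𝓟 S.T) (𝓝 0)).neg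
      rwa [neg_zero] at h2
    refine h1.congr' ?_
    filter_upwards [mem_inf_of_right (mem_principal_self S.T)] with t ht
    rw [hhat t ht, hζh, hψh, hφh, mulVec_add, mulVec_add, mulVec_mulVec, mulVec_mulVec,
      mulVec_mulVec, mulVec_mulVec, hlag t ht, hlag t ht, weylRows_J, weylRows_J_lowerRows,
      zero_mulVec, zero_add, neg_mulVec, one_mulVec]
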